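/- Let $\mathbb{D}=\{z\in\mathbb{C}:|z|<1\}$ and let $(z_n)_{n\in\mathbb{N}}$ be a sequence of distinct points of $\mathbb{D}$. For $\zeta\in\mathbb{C}$ let $n_\zeta(t)$ be the number of indices $k$ with $|z_k-\zeta|\le t$, and let $N_\zeta(r)=\int_0^r \frac{(n_\zeta(t)-1)^+}{t}\,dt$. Let $\psi\colon[1,+\infty)\to[0,+\infty)$ be nondecreasing and unbounded with $\psi(2x)=O(\psi(x))$ as $x\to+\infty$, and put $\tilde\psi(x)=\int_1^x\frac{\psi(t)}{t}\,dt$. The Pólya order $\rho$ of $\psi$ is the infimum of all real $\sigma$ such that $\psi(Ax)\le A^{\sigma}\psi(x)$ for all sufficiently large $A$ and $x$. Let $s\ge[\rho]+1$ be an integer, let $E(w,s)=(1-w)\exp\{w+w^2/2+\dots+w^s/s\}$, and put $$P(z)=\prod_{k} E\Bigl(\frac{1-|z_k|^2}{1-\bar z_k z},s\Bigr),\qquad B_n(z)=\prod_{k\ne n} E\Bigl(\frac{1-|z_k|^2}{1-\bar z_k z},s\Bigr).$$ Assume that there is $C>0$ such that $$n_z\Bigl(\frac{1-|z|}{2}\Bigr)\le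 C\,\psi\Bigl(\frac1{1-|z|}\Bigr)\qquad\text{for all } z\in\mathbb{D}.$$ Consider the following conditions, in which $-\log 0=+\infty$: (a) there is $C>0$ such that $N_{z_n}\bigl(\frac{1-|z_n|}{2}\bigr)\le C\,\tilde\psi\bigl(\frac1{1-|z_n|}\bigr)$ for all $n$; (b) there is $C>0$ such that $-\log\bigl((1-|z_n|)\,|P'(z_n)|\bigr)\le C\,\tilde\psi\bigl(\frac1{1-|z_n|}\bigr)$ for all $n$; (c) there is $C>0$ such that $-\log|B_n(z_n)|\le C\,\tilde\psi\bigl(\frac1{1-|z_n|}\bigr)$ for all $n$. If $z_n\ne0$ for all $n$, then (a), (b) and (c) are equivalent. If at least one of (a), (b), (c) holds, then for every sequence $(b_n)$ of complex numbers such that, for some $C>0$, $\log|b_n|\le C\,\tilde\psi\bigl(\frac1{1-|z_n|}\bigr)$ for all $n$ (with $\log 0=-\infty$), there exists an analytic function $f$ in $\mathbb{D}$ with $f(z_n)=b_n$ for all $n$ and such that, for some $C>0$, $M(r,f)=\max\{|f(z)|:|z|=r\}$ satisfies $$\log M(r,f)\le C\,\tilde\psi\Bigl(\frac1{1-r}\Bigr)\qquad\text{for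 all } r\in(0,1).$$ -/

import Mathlib

open Set Filter Topology MeasureTheory Asymptotics
open scoped ENNReal ComplexConjugate

noncomputable section

namespace DiscInterpolation

/-- The counting function `n_ζ(t)`: the number of members of the sequence `z`
in the closed disc of centre `ζ` and radius `t` (possibly infinite). -/
def counting (z : ℕ → ℂ) (ζ : ℂ) (t : ℝ) : ℕ∞ :=
  {k : ℕ | ‖z k - ζ‖ ≤ t}.encard

/-- The integrated counting function `N_ζ(r) = ∫_0^r (n_ζ(t) - 1)^+ / t dt`, with values in
`[0, ∞]`. The truncated subtraction of `ℕ∞` is the positive part of the difference. -/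
def integratedCounting (z : ℕ → ℂ) (ζ : ℂ) (r : ℝ) : ℝ≥0∞ :=
  ∫⁻ t in Ioc (0 : ℝ) r, ((counting z ζ t - 1 : ℕ∞) : ℝ≥0∞) / ENNReal.ofReal t

/-- The integral `x ↦ ∫_1^x ψ(t) / t dt`. -/
def tilde (ψ : ℝ → ℝ) (x : ℝ) : ℝ :=
  ∫ t in (1 : ℝ)..x, ψ t / t

/-- The Pólya order of `ψ`: the infimum of the real `ρ` such that
`ψ (A x) ≤ A ^ ρ ψ x` for all sufficiently large `A` and `x`. -/
def polyaOrder (ψ : ℝ → ℝ) : ℝ :=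
  sInf {ρ : ℝ | ∃ K : ℝ, ∀ A ≥ K, ∀ x ≥ K, ψ (A * x) ≤ A ^ ρ * ψ x}

/-- The Weierstrass primary factor `E(w, s) = (1 - w) exp (w + w² / 2 + ⋯ + w ^ s / s)`. -/
def primaryFactor (w : ℂ) (s : ℕ) : ℂ :=
  (1 - w) * Complex.exp (∑ j ∈ Finset.Icc 1 s, w ^ j / (j : ℂ))

/-- The `n`-th factor `E((1 - |z_n|²) / (1 - conj z_n * w), s)` of the canonical product. -/
def canonicalFactor (z : ℕ → ℂ) (s n : ℕ) (w : ℂ) : ℂ :=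
  primaryFactor ((1 - (‖z n‖ : ℂ) ^ 2) / (1 - conj (z n) * w)) s

/-- The canonical product `P(w) = ∏_n E((1 - |z_n|²) / (1 - conj z_n * w), s)`. -/
def canonicalProduct (z : ℕ → ℂ) (s : ℕ) (w : ℂ) : ℂ :=
  ∏' n : ℕ, canonicalFactor z s n w

/-- The function `B_n = P / E((1 - |z_n|²) / (1 - conj z_n * w), s)`, i.e. the canonical product
without its `n`-th factor. It is written as a product, because the quotient
has the form `0 / 0` at the point `z_n`. -/
def reducedProduct (z : ℕ → ℂ) (s n : ℕ) (w : ℂ) : ℂ :=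
  ∏' k : {k : ℕ // k ≠ n}, canonicalFactor z s k w

/-- The maximum modulus `M(r, f) = max {|f(w)| : |w| = r}`. -/
def maxModulus (r : ℝ) (f : ℂ → ℂ) : ℝ :=
  sSup ((fun w => ‖f w‖) '' Metric.sphere (0 : ℂ) r)

/-- `N_{z_n}((1 - |z_n|) / 2) ≤ C Ψ(1 / (1 - |z_n|))` for all `n`, with some constant `C`. -/
def IntegratedCountingBound (z : ℕ → ℂ) (Ψ : ℝ → ℝ) : Prop :=
  ∃ C > (0 : ℝ), ∀ n : ℕ, integratedCounting z (z n) ((1 - ‖z n‖) / 2) ≤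
    ENNReal.ofReal (C * Ψ (1 / (1 - ‖z n‖)))

/-- `-log ((1 - |z_n|) |P'(z_n)|) ≤ C Ψ(1 / (1 - |z_n|))` for all `n`, with some constant `C`.
Since `-log 0 = +∞`, this includes `P'(z_n) ≠ 0`. -/
def DerivLowerBound (z : ℕ → ℂ) (s : ℕ) (Ψ : ℝ → ℝ) : Prop :=
  ∃ C > (0 : ℝ), ∀ n : ℕ, deriv (canonicalProduct z s) (z n) ≠ 0 ∧
    -Real.log ((1 - ‖z n‖) * ‖deriv (canonicalProduct z s) (z n)‖) ≤ C * Ψ (1 / (1 - ‖z n‖))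

/-- `-log |B_n(z_n)| ≤ C Ψ(1 / (1 - |z_n|))` for all `n`, with some constant `C`.
Since `-log 0 = +∞`, this includes `B_n(z_n) ≠ 0`. -/
def ReducedProductLowerBound (z : ℕ → ℂ) (s : ℕ) (Ψ : ℝ → ℝ) : Prop :=
  ∃ C > (0 : ℝ), ∀ n : ℕ, reducedProduct z s n (z n) ≠ 0 ∧
    -Real.log ‖reducedProduct z s n (z n)‖ ≤ C * Ψ (1 / (1 - ‖z n‖))

end DiscInterpolation

end

open DiscInterpolation

/-!
Everything rests on one sum estimate. With `uₖ(w) = (1 - |zₖ|) / |1 - conj zₖ w|` (`boundaryRatio`)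
one has `∑ₖ uₖ(w) ^ (s + 1) ≤ C (ψ̃(1 / (1 - |w|)) + 1)`
(`RegularGrowth.tsum_boundaryRatio_le`). Each term is comparable to an average over a
disc around `zₖ` of radius comparable to `1 - |zₖ|`, so the sum is at most an area integral weighted
with the counting function `n_w((1 - |w|) / 2)`, hence with `ψ`. In polar coordinates the angular
integral is a Poisson integral, and the radial one converges because the Pólya order of `ψ` is
less than `s` (`regularGrowth_of_polyaOrder`, `RegularGrowth.lintegral_weight_le`).

As `E(v, s) - 1 = O(|v| ^ (s + 1))`, the sum estimate gives convergence of the products and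
`log |Bₙ(w)| ≤ C (ψ̃ + 1)`. At `w = zₙ` it gives more: the factor with index `k` has modulus
`min(1, 2 |zₖ - zₙ| / (1 - |zₙ|))` up to `exp (O(uₖ ^ (s + 1)))` (`exists_factor_bounds`), and the
sum over `k` of the logarithms of these minima is `-N_{zₙ}((1 - |zₙ|) / 2)`
(`integratedCounting_eq_tsum`). Hence `-log |Bₙ(zₙ)| = N_{zₙ} + O(ψ̃ + 1)`. The derivative
`P'(zₙ)` is `Bₙ(zₙ)` times an explicit factor comparable to `1 / (1 - |zₙ|)`. If no `zₙ` is `0`,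
then `ψ̃(1 / (1 - |zₙ|))` is bounded below (`RegularGrowth.exists_inner_radius`), which absorbs
the `+ 1`, and the three conditions are equivalent.

For interpolation take `f(w) = ∑ₙ bₙ Bₙ(w) / Bₙ(zₙ) vₙ(w) ^ mₙ`, where
`vₙ(w) = (1 - |zₙ|²) / (1 - conj zₙ w)` equals `1` at `zₙ` and `mₙ` is a large multiple of
`ψ̃(1 / (1 - |zₙ|)) + 1` (`RegularGrowth.exists_interpolation`). The bound `exp (C (ψ̃ + 1))` is
uniform in the data, so that a factor `(w / δ) ^ m` can be split off to remove the `+ 1` near the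
origin. If some `zₙ` is `0`, the canonical product vanishes identically, so only the first
condition can hold; the point `0` is then interpolated separately.
-/

namespace DiscInterpolation

/-! ### Growth functions of Pólya order less than `s` -/

/-- The regularity of the growth function that the estimates need: `ψ` is nonnegative and
nondecreasing on `[1, ∞)`, and from any point on it grows at most like a power with an exponent
`σ < s`. The summand `1` in `power` takes care of arguments where `ψ` is small or zero. -/
structure RegularGrowth (ψ : ℝ → ℝ) (s : ℕ) : Prop where
  nonneg : ∀ x ∈ Ici (1 : ℝ), 0 ≤ ψ x
  mono : MonotoneOn ψ (Ici 1)
  power : ∃ C > (0 : ℝ), ∃ σ : ℝ, 0 ≤ σ ∧ σ < s ∧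
    ∀ x : ℝ, 1 ≤ x → ∀ y : ℝ, x ≤ y → ψ y ≤ C * (y / x) ^ σ * (ψ x + 1)

lemma exists_ge_of_not_bddAbove {ψ : ℝ → ℝ} (hm : MonotoneOn ψ (Ici 1))
    (hu : ¬ BddAbove (ψ '' Ici 1)) (M : ℝ) : ∃ x₀ ≥ (1 : ℝ), ∀ x ≥ x₀, M < ψ x := by
  rw [not_bddAbove_iff] at hu
  obtain ⟨_, ⟨x₀, hx₀, rfl⟩, h⟩ := hu M
  exact ⟨x₀, hx₀, fun x hx => h.trans_le (hm hx₀ (le_trans hx₀ hx) hx)⟩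

lemma polyaOrder_nonneg {ψ : ℝ → ℝ} (hm : MonotoneOn ψ (Ici 1))
    (hu : ¬ BddAbove (ψ '' Ici 1)) : 0 ≤ polyaOrder ψ := by
  refine Real.sInf_nonneg ?_
  rintro ρ ⟨K, hK⟩
  by_contra! hρ
  obtain ⟨x₀, hx₀, hpos⟩ := exists_ge_of_not_bddAbove hm hu 0
  set A := max K 2
  set x := max K x₀
  have hA : (2 : ℝ) ≤ A := le_max_right _ _
  have hx : x₀ ≤ x := le_max_right _ _
  have h1 := hK A (le_max_left _ _) x (le_max_left _ _)
  have h2 : ψ x ≤ ψ (A * x) := by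
    refine hm (mem_Ici.2 (by linarith)) (mem_Ici.2 ?_) ?_ <;> nlinarith
  have h3 : A ^ ρ < 1 := Real.rpow_lt_one_of_one_lt_of_neg (by linarith) hρ
  nlinarith [hpos x hx]

lemma polya_exponent_nonempty {ψ : ℝ → ℝ} (hn : ∀ x ∈ Ici (1 : ℝ), 0 ≤ ψ x)
    (hm : MonotoneOn ψ (Ici 1)) (hd : (fun x => ψ (2 * x)) =O[atTop] ψ) :
    {ρ : ℝ | ∃ K : ℝ, ∀ A ≥ K, ∀ x ≥ K, ψ (A * x) ≤ A ^ ρ * ψ x}.Nonempty := by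
  obtain ⟨M₀, hM₀⟩ := hd.bound
  obtain ⟨x₀, hx₀⟩ := eventually_atTop.1 hM₀
  set M := max M₀ 1
  set x₁ := max x₀ 1
  have hM1 : (1 : ℝ) ≤ M := le_max_right _ _
  have hx₁ : (1 : ℝ) ≤ x₁ := le_max_right _ _
  have h2 : ∀ x ≥ x₁, ψ (2 * x) ≤ M * ψ x := by
    intro x hx
    have h := hx₀ x ((le_max_left _ _).trans hx)
    have hp := hn x (hx₁.trans hx)
    rw [Real.norm_eq_abs, Real.norm_eq_abs, abs_of_nonneg hp] at h
    exact (le_abs_self _).trans (h.trans (mul_le_mul_of_nonneg_right (le_max_left _ _) hp))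
  have hpow : ∀ n : ℕ, ∀ x ≥ x₁, ψ (2 ^ n * x) ≤ M ^ n * ψ x := by
    intro n
    induction n with
    | zero => intro x _; simp
    | succ n ih =>
      intro x hx
      have h1 : x₁ ≤ 2 ^ n * x := by
        have : (1 : ℝ) ≤ 2 ^ n := one_le_pow₀ (by norm_num)
        nlinarith
      calc ψ (2 ^ (n + 1) * x) = ψ (2 * (2 ^ n * x)) := by ring_nf
        _ ≤ M * ψ (2 ^ n * x) := h2 _ h1
        _ ≤ M * (M ^ n * ψ x) := by gcongr; exact ih x hx
        _ = M ^ (n + 1) * ψ x := by ring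
  set τ := Real.logb 2 M
  have hτ : 0 ≤ τ := Real.logb_nonneg (by norm_num) hM1
  have hMτ : M = 2 ^ τ := (Real.rpow_logb (by norm_num) (by norm_num) (by linarith)).symm
  refine ⟨2 * τ, max x₁ 2, fun A hA x hx => ?_⟩
  have hA2 : (2 : ℝ) ≤ A := (le_max_right _ _).trans hA
  have hxx : x₁ ≤ x := (le_max_left _ _).trans hx
  obtain ⟨n, hn1, hn2⟩ := exists_nat_pow_near (by linarith : (1 : ℝ) ≤ A) one_lt_two
  have hx0 := hn x (hx₁.trans hxx)
  calc ψ (A * x) ≤ ψ (2 ^ (n + 1) * x) := by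
        refine hm (mem_Ici.2 ?_) (mem_Ici.2 ?_) ?_ <;> nlinarith
    _ ≤ M ^ (n + 1) * ψ x := hpow _ x hxx
    _ ≤ A ^ (2 * τ) * ψ x := by
        gcongr
        rw [hMτ, ← Real.rpow_natCast, ← Real.rpow_mul (by norm_num), mul_comm τ,
          Real.rpow_mul (by norm_num), Real.rpow_mul (by linarith : (0 : ℝ) ≤ A)]
        refine Real.rpow_le_rpow (by positivity) ?_ hτ
        rw [Real.rpow_natCast, Real.rpow_two, pow_succ, sq]
        exact mul_le_mul hn1 hA2 (by norm_num) (by linarith)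

lemma regularGrowth_of_polyaOrder {ψ : ℝ → ℝ} (hn : ∀ x ∈ Ici (1 : ℝ), 0 ≤ ψ x)
    (hm : MonotoneOn ψ (Ici 1)) (hu : ¬ BddAbove (ψ '' Ici 1))
    (hd : (fun x => ψ (2 * x)) =O[atTop] ψ) {s : ℕ} (hs : ⌊polyaOrder ψ⌋ + 1 ≤ (s : ℤ)) :
    1 ≤ s ∧ RegularGrowth ψ s := by
  have h0 := polyaOrder_nonneg hm hu
  have hs1 : 1 ≤ s := by
    have := Int.floor_nonneg.2 h0
    omega
  refine ⟨hs1, hn, hm, ?_⟩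
  have hlt : polyaOrder ψ < s := by
    have h1 := Int.lt_floor_add_one (polyaOrder ψ)
    have h2 : ((⌊polyaOrder ψ⌋ : ℝ) + 1) ≤ s := by exact_mod_cast hs
    linarith
  obtain ⟨ρ, ⟨K₀, hK₀⟩, hρs⟩ := exists_lt_of_csInf_lt (polya_exponent_nonempty hn hm hd) hlt
  set σ := max ρ 0
  set K := max K₀ 1
  have hK1 : (1 : ℝ) ≤ K := le_max_right _ _
  have hσ : 0 ≤ σ := le_max_right _ _
  have hK : ∀ A ≥ K, ∀ x ≥ K, ψ (A * x) ≤ A ^ σ * ψ x := fun A hA x hx =>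
    (hK₀ A ((le_max_left _ _).trans hA) x ((le_max_left _ _).trans hx)).trans
      (mul_le_mul_of_nonneg_right
        (Real.rpow_le_rpow_of_exponent_le (hK1.trans hA) (le_max_left _ _))
        (hn x (hK1.trans hx)))
  have hψK : 0 ≤ ψ (K * K) := hn _ (mem_Ici.2 (by nlinarith))
  have hKσ : 1 ≤ K ^ σ := Real.one_le_rpow hK1 hσ
  refine ⟨K ^ σ + ψ (K * K), by positivity, σ, hσ, max_lt hρs (by exact_mod_cast hs1),
    fun x hx y hxy => ?_⟩
  have hx0 : 0 < x := by linarith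
  have hyx : 1 ≤ y / x := (one_le_div hx0).2 hxy
  have hyxσ : 1 ≤ (y / x) ^ σ := Real.one_le_rpow hyx hσ
  have hψx := hn x hx
  rcases le_total K x with hKx | hKx
  · have hψ : ψ y ≤ K ^ σ * (y / x) ^ σ * ψ x := by
      rcases le_total K (y / x) with h | h
      · have := hK (y / x) h x hKx
        rw [div_mul_cancel₀ _ hx0.ne'] at this
        refine this.trans (mul_le_mul_of_nonneg_right ?_ hψx)
        nlinarith
      · have h1 : y ≤ K * x := (div_le_iff₀ hx0).1 h
        refine (hm (mem_Ici.2 (hx.trans hxy)) (mem_Ici.2 (by nlinarith)) h1).trans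
          ((hK K le_rfl x hKx).trans (mul_le_mul_of_nonneg_right ?_ hψx))
        nlinarith
    refine hψ.trans ?_
    gcongr
    · linarith
    · linarith
  · have hψ : ψ y ≤ (y / x) ^ σ * ψ (K * K) := by
      rcases le_total y (K * K) with h | h
      · have := hm (mem_Ici.2 (hx.trans hxy)) (mem_Ici.2 (by nlinarith)) h
        nlinarith
      · have hyK : K ≤ y / K := (le_div_iff₀ (by linarith)).2 h
        have h1 := hK (y / K) hyK K le_rfl
        rw [div_mul_cancel₀ _ (by linarith)] at h1
        refine h1.trans ?_
        have hKK : ψ K ≤ ψ (K * K) :=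
          hm (mem_Ici.2 hK1) (mem_Ici.2 (by nlinarith)) (by nlinarith)
        have : y / K ≤ y / x := div_le_div_of_nonneg_left (by linarith) hx0 hKx
        have hK0 := hn K hK1
        gcongr
        linarith
    refine hψ.trans ?_
    rw [mul_comm (_ + _), mul_assoc]
    refine mul_le_mul_of_nonneg_left ?_ (by linarith)
    nlinarith

section Tilde

variable {ψ : ℝ → ℝ} {s : ℕ}

lemma RegularGrowth.intervalIntegrable (h : RegularGrowth ψ s) {a b : ℝ} (ha : 1 ≤ a)
    (hb : 1 ≤ b) : IntervalIntegrable (fun t => ψ t / t) volume a b := by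
  have hsub : uIcc a b ⊆ Ici 1 := fun t ht => le_trans (le_min ha hb) ht.1
  simp_rw [div_eq_mul_inv]
  refine (MonotoneOn.intervalIntegrable (h.mono.mono hsub)).mul_continuousOn
    (continuousOn_id.inv₀ fun t ht => ?_)
  have : (1 : ℝ) ≤ t := hsub ht
  simp only [id]; linarith

lemma RegularGrowth.tilde_add (h : RegularGrowth ψ s) {a b : ℝ} (ha : 1 ≤ a) (hb : 1 ≤ b) :
    tilde ψ b = tilde ψ a + ∫ t in a..b, ψ t / t :=
  (intervalIntegral.integral_add_adjacent_intervals (h.intervalIntegrable le_rfl ha)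
    (h.intervalIntegrable ha hb)).symm

lemma RegularGrowth.integral_ge (h : RegularGrowth ψ s) {a b : ℝ} (ha : 1 ≤ a) (hab : a ≤ b) :
    ψ a * Real.log (b / a) ≤ ∫ t in a..b, ψ t / t := by
  have ha0 : 0 < a := by linarith
  have h0 : (0 : ℝ) ∉ uIcc a b := by rw [uIcc_of_le hab]; intro h; linarith [h.1]
  rw [← integral_inv h0, ← intervalIntegral.integral_const_mul]
  refine intervalIntegral.integral_mono_on hab
    ((intervalIntegral.intervalIntegrable_inv (fun t ht => ?_) continuousOn_id).const_mul _)
    (h.intervalIntegrable ha (ha.trans hab)) fun t ht => ?_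
  · rintro rfl; exact h0 ht
  · have : 0 < t := ha0.trans_le ht.1
    rw [div_eq_mul_inv]
    have := h.mono (mem_Ici.2 ha) (mem_Ici.2 (ha.trans ht.1)) ht.1
    gcongr

lemma RegularGrowth.integral_le (h : RegularGrowth ψ s) {a b : ℝ} (ha : 1 ≤ a) (hab : a ≤ b) :
    ∫ t in a..b, ψ t / t ≤ ψ b * Real.log (b / a) := by
  have ha0 : 0 < a := by linarith
  have h0 : (0 : ℝ) ∉ uIcc a b := by rw [uIcc_of_le hab]; intro h; linarith [h.1]
  rw [← integral_inv h0, ← intervalIntegral.integral_const_mul]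
  refine intervalIntegral.integral_mono_on hab (h.intervalIntegrable ha (ha.trans hab))
    ((intervalIntegral.intervalIntegrable_inv (fun t ht => ?_) continuousOn_id).const_mul _)
    fun t ht => ?_
  · rintro rfl; exact h0 ht
  · have : 0 < t := ha0.trans_le ht.1
    rw [div_eq_mul_inv]
    have := h.mono (mem_Ici.2 (ha.trans ht.1)) (mem_Ici.2 (ha.trans hab)) ht.2
    gcongr

lemma RegularGrowth.tilde_mono (h : RegularGrowth ψ s) {a b : ℝ} (ha : 1 ≤ a) (hab : a ≤ b) :
    tilde ψ a ≤ tilde ψ b := by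
  rw [h.tilde_add ha (ha.trans hab)]
  have h1 := h.integral_ge ha hab
  have h2 : 0 ≤ ψ a * Real.log (b / a) :=
    mul_nonneg (h.nonneg a ha) (Real.log_nonneg ((one_le_div (by linarith)).2 hab))
  linarith

lemma RegularGrowth.tilde_nonneg (h : RegularGrowth ψ s) {x : ℝ} (hx : 1 ≤ x) :
    0 ≤ tilde ψ x := by
  simpa [tilde] using h.tilde_mono le_rfl hx

/-- `ψ ≤ C (ψ̃ + 1)`: the part of the integral over `[x / 2, x]` already dominates `ψ`. -/
lemma RegularGrowth.le_tilde (h : RegularGrowth ψ s) :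
    ∃ C > (0 : ℝ), ∀ x : ℝ, 1 ≤ x → ψ x + 1 ≤ C * (tilde ψ x + 1) := by
  obtain ⟨C, hC, σ, hσ, -, hp⟩ := h.power
  have h2 := h.nonneg 2 (mem_Ici.2 (by norm_num))
  refine ⟨C * 2 ^ σ * 2 + ψ 2 + 1, by positivity, fun x hx => ?_⟩
  have ht := h.tilde_nonneg hx
  rcases le_total x 2 with h' | h'
  · have h1 := h.mono (mem_Ici.2 hx) (mem_Ici.2 (by norm_num)) h'
    have : 0 ≤ C * 2 ^ σ * 2 := by positivity
    nlinarith
  · have h1 := hp (x / 2) (by linarith) x (by linarith)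
    have h3 := h.tilde_add (a := x / 2) (b := x) (by linarith) hx
    have h4 := h.integral_ge (a := x / 2) (b := x) (by linarith) (by linarith)
    have h5 := h.tilde_nonneg (x := x / 2) (by linarith)
    have h6 : x / (x / 2) = 2 := by field_simp
    rw [h6] at h1 h4
    have h7 := Real.log_two_gt_d9
    have h8 := h.nonneg (x / 2) (mem_Ici.2 (by linarith))
    have h9 : ψ (x / 2) ≤ 2 * tilde ψ x := by nlinarith
    have h10 : 0 ≤ C * 2 ^ σ := by positivity
    have h11 : C * 2 ^ σ * (ψ (x / 2) + 1) ≤ C * 2 ^ σ * (2 * (tilde ψ x + 1)) :=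
      mul_le_mul_of_nonneg_left (by linarith) h10
    nlinarith

lemma RegularGrowth.tilde_four_mul_le (h : RegularGrowth ψ s) :
    ∃ C > (0 : ℝ), ∀ x : ℝ, 1 ≤ x → tilde ψ (4 * x) + 1 ≤ C * (tilde ψ x + 1) := by
  obtain ⟨C, hC, σ, hσ, -, hp⟩ := h.power
  obtain ⟨D, hD, hle⟩ := h.le_tilde
  refine ⟨1 + C * 4 ^ σ * D * Real.log 4, ?_, fun x hx => ?_⟩
  · have := Real.log_nonneg (by norm_num : (1 : ℝ) ≤ 4)
    positivity
  · have h1 := h.tilde_add (a := x) (b := 4 * x) hx (by linarith)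
    have h2 := h.integral_le (a := x) (b := 4 * x) hx (by linarith)
    have h3 := hp x hx (4 * x) (by linarith)
    rw [show 4 * x / x = 4 by field_simp] at h2 h3
    have h4 := Real.log_nonneg (by norm_num : (1 : ℝ) ≤ 4)
    have h5 : ψ (4 * x) ≤ C * 4 ^ σ * (D * (tilde ψ x + 1)) := by
      refine h3.trans ?_
      gcongr
      exact hle x hx
    nlinarith [mul_le_mul_of_nonneg_right h5 h4]

/-- The weighted integral of `ψ` over `[1, ∞)` that arises from summing over the points of the
disc: the weight is `1` up to `X` and decays fast enough beyond `X`, as `ψ` grows with an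
exponent below `s`. -/
lemma RegularGrowth.lintegral_weight_le (h : RegularGrowth ψ s) :
    ∃ C > (0 : ℝ), ∀ X : ℝ, 1 ≤ X →
      ∫⁻ x in Ioi (1 : ℝ), ENNReal.ofReal (ψ x / x * (min x X / x) ^ s) ≤
        ENNReal.ofReal (C * (tilde ψ X + 1)) := by
  obtain ⟨C, hC, σ, hσ, hσs, hp⟩ := h.power
  obtain ⟨D, hD, hle⟩ := h.le_tilde
  have hsσ : 0 < s - σ := by linarith
  refine ⟨1 + C * D / (s - σ), by positivity, fun X hX => ?_⟩
  have hX0 : 0 < X := by linarith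
  have ht := h.tilde_nonneg hX
  have hsplit : Ioi (1 : ℝ) = Ioc 1 X ∪ Ioi X := (Ioc_union_Ioi_eq_Ioi hX).symm
  rw [hsplit]
  refine (lintegral_union_le _ _ _).trans ?_
  rw [add_mul, ENNReal.ofReal_add (by positivity) (by positivity)]
  gcongr
  · have h1 : ∫⁻ x in Ioc 1 X, ENNReal.ofReal (ψ x / x * (min x X / x) ^ s) =
        ∫⁻ x in Ioc 1 X, ENNReal.ofReal (ψ x / x) := by
      refine setLIntegral_congr_fun measurableSet_Ioc fun x hx => ?_
      have : x ≠ 0 := by linarith [hx.1]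
      simp [min_eq_left hx.2, div_self this]
    rw [h1, ← ofReal_integral_eq_lintegral_ofReal]
    · refine ENNReal.ofReal_le_ofReal ?_
      rw [← intervalIntegral.integral_of_le hX]
      change tilde ψ X ≤ _
      linarith
    · exact (intervalIntegrable_iff_integrableOn_Ioc_of_le hX).1
        (h.intervalIntegrable le_rfl hX)
    · refine (ae_restrict_iff' measurableSet_Ioc).2 (Eventually.of_forall fun x hx => ?_)
      exact div_nonneg (h.nonneg x hx.1.le) (by linarith [hx.1])
  · set c := C * (ψ X + 1) * X ^ (s - σ)
    have hψX := h.nonneg X hX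
    have h1 : ∀ x ∈ Ioi X, ENNReal.ofReal (ψ x / x * (min x X / x) ^ s) ≤
        ENNReal.ofReal (c * x ^ (σ - s - 1)) := by
      intro x hx
      have hx' : X < x := hx
      have hx0 : 0 < x := hX0.trans hx
      refine ENNReal.ofReal_le_ofReal ?_
      rw [min_eq_right hx'.le]
      calc ψ x / x * (X / x) ^ s
          ≤ (C * (x / X) ^ σ * (ψ X + 1)) / x * (X / x) ^ s := by
            gcongr
            exact hp X hX x hx'.le
        _ = c * x ^ (σ - s - 1) := by
            simp only [c]
            rw [Real.div_rpow hx0.le hX0.le, Real.rpow_sub hX0, Real.rpow_sub hx0,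
              Real.rpow_sub hx0, Real.rpow_one, Real.rpow_natCast, Real.rpow_natCast, div_pow]
            field_simp
    refine (setLIntegral_mono' measurableSet_Ioi h1).trans ?_
    have hexp : σ - s - 1 < -1 := by linarith
    rw [← ofReal_integral_eq_lintegral_ofReal]
    · refine ENNReal.ofReal_le_ofReal ?_
      rw [integral_const_mul, integral_Ioi_rpow_of_lt hexp hX0]
      have e1 : σ - s - 1 + 1 = -(s - σ) := by ring
      rw [e1, Real.rpow_neg hX0.le]
      have : 0 < X ^ (s - σ) := by positivity
      have e2 : c * (-(X ^ (s - σ))⁻¹ / -(s - σ)) = C / (s - σ) * (ψ X + 1) := by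
        simp only [c]
        field_simp
      rw [e2]
      calc C / (s - σ) * (ψ X + 1) ≤ C / (s - σ) * (D * (tilde ψ X + 1)) := by
            gcongr; exact hle X hX
        _ = C * D / (s - σ) * (tilde ψ X + 1) := by ring
    · exact (integrableOn_Ioi_rpow_of_lt hexp hX0).const_mul _
    · refine (ae_restrict_iff' measurableSet_Ioi).2 (Eventually.of_forall fun x hx => ?_)
      have : 0 < x := hX0.trans hx
      simp only [Pi.zero_apply]
      positivity

end Tilde

/-! ### Sums over the sequence, compared with area integrals -/

/-- The quantity `(1 - |a|) / |1 - conj a * w|`, comparable to the modulus of the argument of the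
primary factor with zero `a`. -/
noncomputable def boundaryRatio (a w : ℂ) : ℝ := (1 - ‖a‖) / ‖1 - conj a * w‖

lemma one_sub_mul_le_norm (a w : ℂ) : 1 - ‖a‖ * ‖w‖ ≤ ‖1 - conj a * w‖ := by
  have h := norm_sub_norm_le (1 : ℂ) (conj a * w)
  rwa [norm_one, norm_mul, RCLike.norm_conj] at h

lemma one_sub_le_norm_left {a w : ℂ} (hw : ‖w‖ ≤ 1) : 1 - ‖a‖ ≤ ‖1 - conj a * w‖ := by
  have := one_sub_mul_le_norm a w
  nlinarith [norm_nonneg a]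

lemma one_sub_le_norm_right {a w : ℂ} (ha : ‖a‖ ≤ 1) : 1 - ‖w‖ ≤ ‖1 - conj a * w‖ := by
  have := one_sub_mul_le_norm a w
  nlinarith [norm_nonneg w]

lemma norm_one_sub_pos {a w : ℂ} (ha : ‖a‖ < 1) (hw : ‖w‖ < 1) : 0 < ‖1 - conj a * w‖ := by
  have := one_sub_le_norm_left (a := a) hw.le
  linarith

lemma boundaryRatio_pos {a w : ℂ} (ha : ‖a‖ < 1) (hw : ‖w‖ < 1) : 0 < boundaryRatio a w :=
  div_pos (by linarith) (norm_one_sub_pos ha hw)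

lemma boundaryRatio_le_one {a w : ℂ} (ha : ‖a‖ < 1) (hw : ‖w‖ < 1) : boundaryRatio a w ≤ 1 :=
  (div_le_one (norm_one_sub_pos ha hw)).2 (one_sub_le_norm_left hw.le)

/-- The mean of `1 / |1 - conj w * z|²` over the circle `|w| = ρ`, from the Poisson formula. -/
lemma lintegral_circle_le {z : ℂ} (hz : ‖z‖ < 1) {ρ : ℝ} (h0 : 0 ≤ ρ) (h1 : ρ < 1) :
    ∫⁻ θ in Ioo (-Real.pi) Real.pi,
      ENNReal.ofReal (1 / ‖1 - conj (Complex.polarCoord.symm (ρ, θ)) * z‖ ^ 2) ≤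
      ENNReal.ofReal (2 * Real.pi / (1 - ρ * ‖z‖)) := by
  set v : ℂ := ρ * z
  have hv : ‖v‖ = ρ * ‖z‖ := by simp [v, abs_of_nonneg h0]
  have hv1 : ‖v‖ < 1 := by rw [hv]; nlinarith [norm_nonneg z]
  have hnorm : ∀ θ : ℝ, ‖1 - conj (Complex.polarCoord.symm (ρ, θ)) * z‖ =
      ‖circleMap 0 1 θ - v‖ := by
    intro θ
    have e1 : conj (Complex.polarCoord.symm (ρ, θ)) = ρ * conj (circleMap 0 1 θ) := by
      rw [Complex.polarCoord_symm_apply, map_mul, Complex.conj_ofReal]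
      congr 2
      simp [circleMap, Complex.exp_mul_I]
    have e2 : circleMap 0 1 θ * conj (circleMap 0 1 θ) = 1 := by
      rw [Complex.mul_conj, Complex.normSq_eq_norm_sq]
      simp
    have e3 : circleMap 0 1 θ - v =
        circleMap 0 1 θ * (1 - conj (Complex.polarCoord.symm (ρ, θ)) * z) := by
      rw [e1]
      simp only [v]
      linear_combination ((ρ : ℂ) * z) * e2
    rw [e3, norm_mul]
    simp
  have hne : ∀ θ : ℝ, ‖circleMap 0 1 θ - v‖ ^ 2 ≠ 0 := by
    intro θ
    have h := norm_sub_norm_le (circleMap 0 1 θ) v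
    have h' : ‖circleMap 0 1 θ‖ = 1 := by simp
    have : 0 < ‖circleMap 0 1 θ - v‖ := by linarith
    positivity
  have hcont : Continuous fun θ : ℝ => 1 / ‖circleMap 0 1 θ - v‖ ^ 2 :=
    continuous_const.div (by fun_prop) hne
  have hP : Real.circleAverage (poissonKernel 0 v • fun _ => (1 : ℂ)) 0 1 = 1 :=
    (diffContOnCl_const (c := (1 : ℂ))).circleAverage_poissonKernel_smul (by simpa using hv1)
  have hint : (1 - ‖v‖ ^ 2) * ∫ θ in (-Real.pi)..Real.pi, 1 / ‖circleMap 0 1 θ - v‖ ^ 2 =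
      2 * Real.pi := by
    rw [Real.circleAverage_eq_integral_add (-Real.pi)] at hP
    simp only [Pi.smul_apply', Complex.real_smul, mul_one] at hP
    rw [intervalIntegral.integral_ofReal,
      intervalIntegral.integral_comp_add_right
        (fun θ => poissonKernel 0 v (circleMap 0 1 θ))] at hP
    have hP' : (2 * Real.pi)⁻¹ *
        ∫ θ in (0 + -Real.pi)..(2 * Real.pi + -Real.pi), poissonKernel 0 v (circleMap 0 1 θ) =
        1 := by exact_mod_cast hP
    rw [show 0 + -Real.pi = -Real.pi by ring, show 2 * Real.pi + -Real.pi = Real.pi by ring] at hP'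
    rw [← intervalIntegral.integral_const_mul]
    have e : ∀ θ, poissonKernel 0 v (circleMap 0 1 θ) =
        (1 - ‖v‖ ^ 2) * (1 / ‖circleMap 0 1 θ - v‖ ^ 2) := by
      intro θ
      simp [poissonKernel_def, div_eq_mul_inv]
    simp_rw [e] at hP'
    have hpi := Real.pi_pos
    field_simp at hP' ⊢
    linarith
  have hpi := Real.pi_pos
  simp_rw [hnorm]
  rw [← ofReal_integral_eq_lintegral_ofReal]
  · refine ENNReal.ofReal_le_ofReal ?_
    rw [← integral_Ioc_eq_integral_Ioo, ← intervalIntegral.integral_of_le (by linarith)]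
    rw [le_div_iff₀ (by rw [← hv]; linarith), ← hint, ← hv, mul_comm]
    refine mul_le_mul_of_nonneg_right ?_ ?_
    · nlinarith [norm_nonneg v]
    · exact intervalIntegral.integral_nonneg (by linarith) fun θ _ => by positivity
  · exact (hcont.integrableOn_Icc (a := -Real.pi) (b := Real.pi)).mono_set Ioo_subset_Icc_self
  · exact Eventually.of_forall fun θ => by positivity

/-- Integration over the disc in polar coordinates, with `x = 1 / (1 - ρ)` as the radial
variable. -/
lemma RegularGrowth.lintegral_ball_le {ψ : ℝ → ℝ} {m : ℕ} (h : RegularGrowth ψ (m + 1)) :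
    ∃ C > (0 : ℝ), ∀ z : ℂ, ‖z‖ < 1 →
      ∫⁻ w in Metric.ball (0 : ℂ) 1, ENNReal.ofReal (ψ (1 / (1 - ‖w‖))) *
        ENNReal.ofReal ((1 - ‖w‖) ^ m / ‖1 - conj w * z‖ ^ (m + 2)) ≤
      ENNReal.ofReal (C * (tilde ψ (1 / (1 - ‖z‖)) + 1)) := by
  obtain ⟨C, hC, hle⟩ := h.lintegral_weight_le
  have hpi := Real.pi_pos
  refine ⟨2 * Real.pi * C, by positivity, fun z hz => ?_⟩
  set X := 1 / (1 - ‖z‖)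
  have hz0 := norm_nonneg z
  have hz1 : 0 < 1 - ‖z‖ := by linarith
  have hX : 1 ≤ X := (one_le_div hz1).2 (by linarith)
  have hX0 : 0 < X := by linarith
  set g : ℝ → ℝ≥0∞ := fun ρ => ENNReal.ofReal (ψ (1 / (1 - ρ)) *
    ((1 - ρ) / (1 - ρ * ‖z‖)) ^ m * (2 * Real.pi / (1 - ρ * ‖z‖)))
  -- the angular integral, for a fixed radius
  have hang : ∀ ρ ∈ Ioo (0 : ℝ) 1, ∫⁻ θ in Ioo (-Real.pi) Real.pi, ENNReal.ofReal ρ *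
      (ENNReal.ofReal (ψ (1 / (1 - ρ))) * ENNReal.ofReal ((1 - ρ) ^ m /
        ‖1 - conj (Complex.polarCoord.symm (ρ, θ)) * z‖ ^ (m + 2))) ≤ g ρ := by
    intro ρ hρ
    have hρ1 : 0 < 1 - ρ := by linarith [hρ.2]
    have hρz : 0 < 1 - ρ * ‖z‖ := by nlinarith [hρ.1]
    have hψ : 0 ≤ ψ (1 / (1 - ρ)) :=
      h.nonneg _ (mem_Ici.2 ((one_le_div hρ1).2 (by linarith [hρ.1])))
    have hpt : ∀ θ : ℝ, ENNReal.ofReal ρ *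
        (ENNReal.ofReal (ψ (1 / (1 - ρ))) * ENNReal.ofReal ((1 - ρ) ^ m /
          ‖1 - conj (Complex.polarCoord.symm (ρ, θ)) * z‖ ^ (m + 2))) ≤
        ENNReal.ofReal (ψ (1 / (1 - ρ)) * ((1 - ρ) / (1 - ρ * ‖z‖)) ^ m) *
          ENNReal.ofReal (1 / ‖1 - conj (Complex.polarCoord.symm (ρ, θ)) * z‖ ^ 2) := by
      intro θ
      set q := ‖1 - conj (Complex.polarCoord.symm (ρ, θ)) * z‖
      have hq : 1 - ρ * ‖z‖ ≤ q := by
        have := one_sub_mul_le_norm (Complex.polarCoord.symm (ρ, θ)) z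
        rwa [Complex.norm_polarCoord_symm, abs_of_pos hρ.1] at this
      rw [← ENNReal.ofReal_mul hψ, ← ENNReal.ofReal_mul hρ.1.le,
        ← ENNReal.ofReal_mul (by positivity)]
      refine ENNReal.ofReal_le_ofReal ?_
      calc ρ * (ψ (1 / (1 - ρ)) * ((1 - ρ) ^ m / q ^ (m + 2)))
          ≤ 1 * (ψ (1 / (1 - ρ)) * ((1 - ρ) ^ m / q ^ (m + 2))) := by
            have : 0 < q := hρz.trans_le hq
            gcongr
            exact hρ.2.le
        _ = ψ (1 / (1 - ρ)) * ((1 - ρ) ^ m / q ^ m) * (1 / q ^ 2) := by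
            have : 0 < q := hρz.trans_le hq
            field_simp
            ring
        _ ≤ _ := by
            rw [div_pow]
            gcongr
    refine (lintegral_mono hpt).trans ?_
    rw [lintegral_const_mul' _ _ ENNReal.ofReal_ne_top]
    refine (mul_le_mul_right (lintegral_circle_le hz hρ.1.le hρ.2) _).trans ?_
    rw [← ENNReal.ofReal_mul (by positivity)]
  -- the radial integral
  have himg : (fun x : ℝ => 1 - 1 / x) '' Ioi 1 = Ioo 0 1 := by
    ext ρ
    constructor
    · rintro ⟨x, hx, rfl⟩
      have hx' : (1 : ℝ) < x := hx
      have h1 : 0 < 1 / x := by positivity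
      have h2 : 1 / x < 1 := (div_lt_one (by linarith)).2 hx'
      exact ⟨by simp only; linarith, by simp only; linarith⟩
    · rintro ⟨h1, h2⟩
      refine ⟨1 / (1 - ρ), ?_, by simp⟩
      rw [mem_Ioi, lt_div_iff₀ (by linarith)]
      linarith
  have hrad : ∫⁻ ρ in Ioo (0 : ℝ) 1, g ρ ≤
      ENNReal.ofReal (2 * Real.pi * C * (tilde ψ X + 1)) := by
    rw [← himg, lintegral_image_eq_lintegral_abs_deriv_mul measurableSet_Ioi
      (f' := fun x => 1 / x ^ 2) (fun x hx => ?_) (fun x hx y hy hxy => ?_)]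
    · have hpt : ∀ x ∈ Ioi (1 : ℝ), ENNReal.ofReal |1 / x ^ 2| * g (1 - 1 / x) ≤
          ENNReal.ofReal (2 * Real.pi) *
            ENNReal.ofReal (ψ x / x * (min x X / x) ^ (m + 1)) := by
        intro x hx
        have hx' : (1 : ℝ) < x := hx
        have hx0 : 0 < x := by linarith
        have hψ := h.nonneg x hx'.le
        rw [← ENNReal.ofReal_mul (abs_nonneg _), ← ENNReal.ofReal_mul (by positivity)]
        refine ENNReal.ofReal_le_ofReal ?_
        have e1 : 1 - (1 - 1 / x) = 1 / x := by ring
        rw [e1, one_div_one_div, abs_of_pos (by positivity)]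
        have hmin : 0 < min x X := lt_min hx0 hX0
        have hden : 1 / min x X ≤ 1 - (1 - 1 / x) * ‖z‖ := by
          have h1 : 1 / x ≤ 1 := (div_le_one hx0).2 hx'.le
          have h2 : 0 < 1 / x := by positivity
          rcases min_choice x X with e | e <;> rw [e]
          · nlinarith
          · simp only [X, one_div_one_div]
            nlinarith
        set q := 1 - (1 - 1 / x) * ‖z‖
        have hq : 0 < q := lt_of_lt_of_le (by positivity) hden
        have hq' : 1 / q ≤ min x X := (one_div_le hq hmin).2 hden
        calc 1 / x ^ 2 * (ψ x * (1 / x / q) ^ m * (2 * Real.pi / q))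
            = 2 * Real.pi * (ψ x / x * ((1 / q) / x) ^ (m + 1)) := by
              rw [div_right_comm 1 q x, pow_succ _ m]
              generalize (1 / x / q) ^ m = A
              field_simp
          _ ≤ _ := by gcongr
      refine (setLIntegral_mono' measurableSet_Ioi hpt).trans ?_
      rw [lintegral_const_mul' _ _ ENNReal.ofReal_ne_top]
      refine (mul_le_mul_right (hle X hX) _).trans ?_
      rw [← ENNReal.ofReal_mul (by positivity), mul_assoc (2 * Real.pi)]
    · have hx0 : x ≠ 0 := by have : (1 : ℝ) < x := hx; linarith
      have := ((hasDerivAt_id x).fun_inv hx0).const_sub 1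
      simp only [id, one_div] at this ⊢
      refine HasDerivAt.hasDerivWithinAt ?_
      convert! this using 1
      field_simp
    · simpa using hxy
  -- polar coordinates
  rw [← lintegral_indicator Metric.isOpen_ball.measurableSet,
    ← Complex.lintegral_comp_polarCoord_symm, polarCoord_target, Measure.volume_eq_prod,
    ← Measure.prod_restrict]
  refine (lintegral_prod_le _).trans ?_
  have hpt : ∀ ρ ∈ Ioi (0 : ℝ), ∫⁻ θ in Ioo (-Real.pi) Real.pi, ENNReal.ofReal ρ •
      (Metric.ball (0 : ℂ) 1).indicator (fun w => ENNReal.ofReal (ψ (1 / (1 - ‖w‖))) *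
        ENNReal.ofReal ((1 - ‖w‖) ^ m / ‖1 - conj w * z‖ ^ (m + 2)))
        (Complex.polarCoord.symm (ρ, θ)) ≤ (Ioo (0 : ℝ) 1).indicator g ρ := by
    intro ρ hρ
    have hρ' : (0 : ℝ) < ρ := hρ
    by_cases h1 : ρ < 1
    · rw [indicator_of_mem (show ρ ∈ Ioo (0 : ℝ) 1 from ⟨hρ, h1⟩)]
      refine le_trans (le_of_eq ?_) (hang ρ ⟨hρ, h1⟩)
      refine lintegral_congr fun θ => ?_
      have hn : ‖Complex.polarCoord.symm (ρ, θ)‖ = ρ := by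
        rw [Complex.norm_polarCoord_symm, abs_of_pos hρ']
      rw [indicator_of_mem (by rw [mem_ball_zero_iff, hn]; exact h1), hn, smul_eq_mul]
    · have : ∀ θ : ℝ, Complex.polarCoord.symm (ρ, θ) ∉ Metric.ball (0 : ℂ) 1 := by
        intro θ
        rwa [mem_ball_zero_iff, Complex.norm_polarCoord_symm, abs_of_pos hρ']
      simp only [indicator_of_notMem (this _), smul_zero, lintegral_zero, zero_le]
  refine (setLIntegral_mono' measurableSet_Ioi hpt).trans ?_
  rw [setLIntegral_indicator measurableSet_Ioo]
  exact (lintegral_mono_set inter_subset_left).trans hrad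

/-- The value at `a` is controlled by the area integral over the points `w` whose disc
`D(w, (1 - |w|) / 2)` contains `a`, as all quantities are comparable near `a`. -/
lemma ofReal_boundaryRatio_pow_le (m : ℕ) :
    ∃ K > (0 : ℝ), ∀ a z : ℂ, ‖a‖ < 1 → ‖z‖ < 1 →
      ENNReal.ofReal (boundaryRatio a z ^ (m + 2)) ≤ ENNReal.ofReal K *
        ∫⁻ w, {w : ℂ | ‖a - w‖ ≤ (1 - ‖w‖) / 2}.indicator
          (fun w => ENNReal.ofReal ((1 - ‖w‖) ^ m / ‖1 - conj w * z‖ ^ (m + 2))) w := by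
  have hpi := Real.pi_pos
  set c : ℝ := (3 / 4) ^ m * (4 / 5) ^ (m + 2)
  have hc : 0 < c := by positivity
  refine ⟨16 / (c * Real.pi), by positivity, fun a z ha hz => ?_⟩
  have ha1 : 0 < 1 - ‖a‖ := by linarith
  set R := (1 - ‖a‖) / 4 with hR
  set p := ‖1 - conj a * z‖
  have hp : 0 < p := norm_one_sub_pos ha hz
  have hpa : 1 - ‖a‖ ≤ p := one_sub_le_norm_left hz.le
  have hpt : ∀ w ∈ Metric.closedBall a R, ENNReal.ofReal (c * (1 - ‖a‖) ^ m / p ^ (m + 2)) ≤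
      {w : ℂ | ‖a - w‖ ≤ (1 - ‖w‖) / 2}.indicator
          (fun w => ENNReal.ofReal ((1 - ‖w‖) ^ m / ‖1 - conj w * z‖ ^ (m + 2))) w := by
    intro w hw
    have hwa : ‖a - w‖ ≤ R := by rwa [mem_closedBall_iff_norm'] at hw
    have h1 : ‖w‖ - ‖a‖ ≤ ‖a - w‖ := by rw [norm_sub_rev]; exact norm_sub_norm_le _ _
    have h3 : 3 / 4 * (1 - ‖a‖) ≤ 1 - ‖w‖ := by rw [hR] at hwa; linarith
    rw [indicator_of_mem (show w ∈ {w : ℂ | ‖a - w‖ ≤ (1 - ‖w‖) / 2} by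
      rw [mem_ofPred_eq]; rw [hR] at hwa; linarith)]
    refine ENNReal.ofReal_le_ofReal ?_
    have hq : ‖1 - conj w * z‖ ≤ 5 / 4 * p := by
      have e : 1 - conj w * z = (1 - conj a * z) + conj (a - w) * z := by
        rw [map_sub]; ring
      have : ‖conj (a - w) * z‖ ≤ R := by
        rw [norm_mul, RCLike.norm_conj]
        nlinarith [norm_nonneg (a - w), norm_nonneg z]
      rw [e]
      refine (norm_add_le _ _).trans ?_
      rw [hR] at this
      linarith
    have hw1 : ‖w‖ < 1 := by linarith
    have hq0 : 0 < ‖1 - conj w * z‖ := norm_one_sub_pos hw1 hz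
    calc c * (1 - ‖a‖) ^ m / p ^ (m + 2)
        = (3 / 4 * (1 - ‖a‖)) ^ m / (5 / 4 * p) ^ (m + 2) := by
          simp only [c]
          rw [mul_pow, mul_pow, show (4 / 5 : ℝ) = (5 / 4)⁻¹ by norm_num, inv_pow]
          field_simp
      _ ≤ _ := by gcongr
  have hbound := (setLIntegral_mono' (μ := volume)
    Metric.isClosed_closedBall.measurableSet hpt).trans (setLIntegral_le_lintegral (Metric.closedBall a R) _)
  rw [setLIntegral_const, Complex.volume_closedBall] at hbound
  refine le_trans (le_of_eq ?_) (mul_le_mul_right hbound _)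
  have hπ : ((NNReal.pi : NNReal) : ℝ≥0∞) = ENNReal.ofReal Real.pi := by
    rw [ENNReal.ofReal, ENNReal.coe_inj]
    ext
    simp [Real.pi_pos.le]
  rw [hπ, ← ENNReal.ofReal_pow (by positivity), ← ENNReal.ofReal_mul (by positivity),
    ← ENNReal.ofReal_mul (by positivity), ← ENNReal.ofReal_mul (by positivity)]
  congr 1
  rw [boundaryRatio, hR, div_pow]
  change (1 - ‖a‖) ^ (m + 2) / p ^ (m + 2) = _
  field_simp
  ring

/-- The fundamental sum estimate: `∑ₖ ((1 - |zₖ|) / |1 - conj zₖ w|) ^ (s + 1)` is bounded by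
`ψ̃ (1 / (1 - |w|)) + 1` up to a constant. -/
lemma RegularGrowth.tsum_boundaryRatio_le {ψ : ℝ → ℝ} {z : ℕ → ℂ} (hz : ∀ n, ‖z n‖ < 1) {s : ℕ} (hs : 1 ≤ s)
    (h : RegularGrowth ψ s)
    (hcount : ∃ C > (0 : ℝ), ∀ w : ℂ, ‖w‖ < 1 →
      ((counting z w ((1 - ‖w‖) / 2) : ℕ∞) : ENNReal) ≤
        ENNReal.ofReal (C * ψ (1 / (1 - ‖w‖)))) :
    ∃ C > (0 : ℝ), ∀ w : ℂ, ‖w‖ < 1 →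
      ∑' k, ENNReal.ofReal (boundaryRatio (z k) w ^ (s + 1)) ≤
        ENNReal.ofReal (C * (tilde ψ (1 / (1 - ‖w‖)) + 1)) := by
  obtain ⟨m, rfl⟩ : ∃ m, s = m + 1 := ⟨s - 1, by omega⟩
  obtain ⟨C₁, hC₁, hcount⟩ := hcount
  obtain ⟨C₂, hC₂, hball⟩ := h.lintegral_ball_le
  obtain ⟨K, hK, hpt⟩ := ofReal_boundaryRatio_pow_le m
  refine ⟨K * C₁ * C₂, by positivity, fun v hv => ?_⟩
  set H : ℂ → ℝ≥0∞ := fun w => ENNReal.ofReal ((1 - ‖w‖) ^ m / ‖1 - conj w * v‖ ^ (m + 2))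
  set A : ℕ → Set ℂ := fun k => {w : ℂ | ‖z k - w‖ ≤ (1 - ‖w‖) / 2}
  have hA : ∀ k, MeasurableSet (A k) := fun k =>
    (isClosed_le (by fun_prop) (by fun_prop)).measurableSet
  have hHm : Measurable H := by
    refine Measurable.ennreal_ofReal (Measurable.div (by fun_prop) ?_)
    exact (Continuous.measurable (by fun_prop))
  calc ∑' k, ENNReal.ofReal (boundaryRatio (z k) v ^ (m + 2))
      ≤ ∑' k, ENNReal.ofReal K * ∫⁻ w, (A k).indicator H w :=
        ENNReal.tsum_le_tsum fun k => hpt (z k) v (hz k) hv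
    _ = ENNReal.ofReal K * ∫⁻ w, ∑' k, (A k).indicator H w := by
        rw [ENNReal.tsum_mul_left, lintegral_tsum fun k => (hHm.indicator (hA k)).aemeasurable]
    _ ≤ ENNReal.ofReal K * ∫⁻ w in Metric.ball (0 : ℂ) 1, ENNReal.ofReal C₁ *
          (ENNReal.ofReal (ψ (1 / (1 - ‖w‖))) * H w) := by
        refine mul_le_mul_right ?_ _
        rw [← lintegral_indicator Metric.isOpen_ball.measurableSet]
        refine lintegral_mono fun w => ?_
        by_cases hw : ‖w‖ < 1
        · rw [indicator_of_mem (by rwa [mem_ball_zero_iff])]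
          have e : ∑' k, (A k).indicator H w =
              ((counting z w ((1 - ‖w‖) / 2) : ℕ∞) : ENNReal) * H w := by
            rw [counting, ← ENNReal.tsum_set_const,
              tsum_subtype {k | ‖z k - w‖ ≤ (1 - ‖w‖) / 2} (fun _ => H w)]
            rfl
          rw [e, ← mul_assoc, ← ENNReal.ofReal_mul hC₁.le]
          exact mul_le_mul_left (hcount w hw) _
        · have : ∀ k, w ∉ A k := by
            intro k hk
            have h1 : ‖z k - w‖ ≤ (1 - ‖w‖) / 2 := hk
            have h2 := norm_sub_norm_le w (z k)
            rw [norm_sub_rev] at h2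
            linarith [hz k]
          simp [indicator_of_notMem (this _)]
    _ ≤ _ := by
        rw [lintegral_const_mul' _ _ ENNReal.ofReal_ne_top]
        refine (mul_le_mul_right (mul_le_mul_right (hball v hv) _) _).trans ?_
        rw [← ENNReal.ofReal_mul hC₁.le, ← ENNReal.ofReal_mul hK.le]
        exact ENNReal.ofReal_le_ofReal (le_of_eq (by ring))

/-! ### The primary factor -/

/-- A bound for the exponent `w + w² / 2 + ⋯ + w ^ s / s` on `|w| ≤ 2`. -/
noncomputable def exponentBound (s : ℕ) : ℝ := ∑ j ∈ Finset.Icc 1 s, (2 : ℝ) ^ j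

lemma exponentBound_nonneg (s : ℕ) : 0 ≤ exponentBound s :=
  Finset.sum_nonneg fun _ _ => by positivity

lemma norm_exponent_le {w : ℂ} (hw : ‖w‖ ≤ 2) (s : ℕ) :
    ‖∑ j ∈ Finset.Icc 1 s, w ^ j / (j : ℂ)‖ ≤ exponentBound s := by
  refine norm_sum_le_of_le _ fun j hj => ?_
  have hj1 : (1 : ℝ) ≤ j := by exact_mod_cast (Finset.mem_Icc.1 hj).1
  rw [norm_div, norm_pow, Complex.norm_natCast]
  exact (div_le_self (by positivity) hj1).trans (by gcongr)

lemma norm_exp_exponent_le {w : ℂ} (hw : ‖w‖ ≤ 2) (s : ℕ) :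
    ‖Complex.exp (∑ j ∈ Finset.Icc 1 s, w ^ j / (j : ℂ))‖ ≤ Real.exp (exponentBound s) := by
  rw [Complex.norm_exp]
  exact Real.exp_le_exp.2 ((Complex.re_le_norm _).trans (norm_exponent_le hw s))

lemma le_norm_exp_exponent {w : ℂ} (hw : ‖w‖ ≤ 2) (s : ℕ) :
    Real.exp (-exponentBound s) ≤ ‖Complex.exp (∑ j ∈ Finset.Icc 1 s, w ^ j / (j : ℂ))‖ := by
  rw [Complex.norm_exp]
  exact Real.exp_le_exp.2 (neg_le_of_neg_le
    ((neg_le_abs _).trans ((Complex.abs_re_le_norm _).trans (norm_exponent_le hw s))))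

/-- The derivative of `E(·, s)` telescopes to `-w ^ s exp (⋯)`, so `E - 1` vanishes at `0` to
order `s + 1`. -/
lemma hasDerivAt_primaryFactor (s : ℕ) (w : ℂ) :
    HasDerivAt (fun w => primaryFactor w s)
      (-(w ^ s * Complex.exp (∑ j ∈ Finset.Icc 1 s, w ^ j / (j : ℂ)))) w := by
  have hp : HasDerivAt (fun w : ℂ => ∑ j ∈ Finset.Icc 1 s, w ^ j / (j : ℂ))
      (∑ j ∈ Finset.range s, w ^ j) w := by
    have e : ∑ j ∈ Finset.range s, w ^ j = ∑ j ∈ Finset.Icc 1 s, (j * w ^ (j - 1)) / (j : ℂ) := by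
      rw [Finset.range_eq_Ico, Finset.sum_Ico_eq_sum_range]
      rw [show Finset.Icc 1 s = Finset.Ico 1 (s + 1) by rfl, Finset.sum_Ico_eq_sum_range]
      refine Finset.sum_congr (by simp) fun j _ => ?_
      have : ((1 + j : ℕ) : ℂ) ≠ 0 := by exact_mod_cast (by omega : 1 + j ≠ 0)
      rw [mul_div_cancel_left₀ _ this]
      simp
    rw [e]
    exact HasDerivAt.fun_sum fun j _ => (hasDerivAt_pow j w).div_const _
  have h := ((hasDerivAt_id w).const_sub 1).mul hp.cexp
  have hg : (1 - w) * ∑ j ∈ Finset.range s, w ^ j = 1 - w ^ s := by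
    rw [mul_comm, geom_sum_mul_neg]
  refine h.congr_deriv ?_
  simp only [id]
  linear_combination Complex.exp (∑ j ∈ Finset.Icc 1 s, w ^ j / (j : ℂ)) * hg

lemma norm_primaryFactor_sub_one_le {w : ℂ} (hw : ‖w‖ ≤ 2) (s : ℕ) :
    ‖primaryFactor w s - 1‖ ≤ Real.exp (exponentBound s) * ‖w‖ ^ (s + 1) := by
  have h := (convex_closedBall (0 : ℂ) ‖w‖).norm_image_sub_le_of_norm_hasDerivWithin_le
    (f := fun w => primaryFactor w s) (C := ‖w‖ ^ s * Real.exp (exponentBound s)) (x := 0) (y := w)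
    (fun v _ => (hasDerivAt_primaryFactor s v).hasDerivWithinAt) (fun v hv => ?_)
    (by simp) (by simp)
  · have h0 : primaryFactor 0 s = 1 := by
      rw [primaryFactor, Finset.sum_eq_zero]
      · simp
      · intro j hj
        have := (Finset.mem_Icc.1 hj).1
        simp [show j ≠ 0 by omega]
    simp only [h0, sub_zero] at h
    exact h.trans (le_of_eq (by ring))
  · have hv' : ‖v‖ ≤ ‖w‖ := by simpa using hv
    rw [norm_neg, norm_mul, norm_pow]
    gcongr
    exact norm_exp_exponent_le (hv'.trans hw) s

lemma norm_primaryFactor_le {w : ℂ} (hw : ‖w‖ ≤ 2) (s : ℕ) :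
    ‖primaryFactor w s‖ ≤ Real.exp (Real.exp (exponentBound s) * ‖w‖ ^ (s + 1)) := by
  have h1 := norm_primaryFactor_sub_one_le hw s
  have h2 := norm_le_norm_sub_add (primaryFactor w s) 1
  rw [norm_one] at h2
  exact (h2.trans (by linarith)).trans (Real.add_one_le_exp _)

/-- Away from its zero at `1`, the primary factor is bounded below. -/
lemma exists_le_norm_primaryFactor (s : ℕ) {d : ℝ} (hd : 0 < d) :
    ∃ C > (0 : ℝ), ∀ w : ℂ, ‖w‖ ≤ 2 → d ≤ ‖1 - w‖ →
      Real.exp (-(C * ‖w‖ ^ (s + 1))) ≤ ‖primaryFactor w s‖ := by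
  set K := Real.exp (exponentBound s)
  have hK : 0 < K := Real.exp_pos _
  set L := |Real.log d| + exponentBound s
  have hL : 0 ≤ L := add_nonneg (abs_nonneg _) (exponentBound_nonneg s)
  refine ⟨2 * K + L * (2 * K), by positivity, fun w hw hdw => ?_⟩
  set t := ‖w‖ ^ (s + 1)
  have ht : 0 ≤ t := by positivity
  rcases le_total (K * t) (1 / 2) with h | h
  · -- `1 - x ≥ exp (-2 x)` for `x ≤ 1 / 2`
    have h1 := norm_primaryFactor_sub_one_le hw s
    have h2 := norm_sub_norm_le (1 : ℂ) (1 - primaryFactor w s)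
    rw [norm_one, sub_sub_cancel, norm_sub_rev] at h2
    have h3 : Real.exp (-(2 * (K * t))) ≤ 1 - K * t := by
      rw [Real.exp_neg, inv_le_comm₀ (Real.exp_pos _) (by linarith)]
      have h4 := Real.add_one_le_exp (2 * (K * t))
      refine le_trans ?_ h4
      rw [inv_le_iff_one_le_mul₀ (by linarith)]
      have : 0 ≤ K * t := by positivity
      nlinarith
    have h5 : -((2 * K + L * (2 * K)) * t) ≤ -(2 * (K * t)) := by
      have : 0 ≤ L * (2 * K) * t := by positivity
      nlinarith
    exact (Real.exp_le_exp.2 h5).trans (h3.trans (by linarith))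
  · rw [primaryFactor, norm_mul]
    have h1 : -((2 * K + L * (2 * K)) * t) ≤ Real.log d + -exponentBound s := by
      have : L ≤ L * (2 * (K * t)) := le_mul_of_one_le_right hL (by linarith)
      have h2 := neg_abs_le (Real.log d)
      have h3 : -L = -|Real.log d| - exponentBound s := by simp only [L]; ring
      have h4 : 0 ≤ 2 * K * t := by positivity
      nlinarith
    refine (Real.exp_le_exp.2 h1).trans ?_
    rw [Real.exp_add, Real.exp_log hd]
    exact mul_le_mul hdw (le_norm_exp_exponent hw s) (Real.exp_pos _).le (norm_nonneg _)

/-! ### The factors of the canonical product -/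

/-- The argument `(1 - |a|²) / (1 - conj a * w)` of the primary factor with zero `a`. -/
noncomputable def factorArg (a w : ℂ) : ℂ := (1 - (‖a‖ : ℂ) ^ 2) / (1 - conj a * w)

lemma canonicalFactor_eq (z : ℕ → ℂ) (s n : ℕ) (w : ℂ) :
    canonicalFactor z s n w = primaryFactor (factorArg (z n) w) s := rfl

lemma norm_factorArg_eq {a w : ℂ} (ha : ‖a‖ < 1) :
    ‖factorArg a w‖ = (1 + ‖a‖) * boundaryRatio a w := by
  have e : (1 - (‖a‖ : ℂ) ^ 2) = ((1 - ‖a‖ ^ 2 : ℝ) : ℂ) := by push_cast; ring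
  have h : 0 ≤ 1 - ‖a‖ ^ 2 := by nlinarith [norm_nonneg a]
  rw [factorArg, boundaryRatio, norm_div, e, Complex.norm_real, Real.norm_of_nonneg h]
  ring

lemma norm_factorArg_le {a w : ℂ} (ha : ‖a‖ < 1) (hw : ‖w‖ < 1) :
    ‖factorArg a w‖ ≤ 2 * boundaryRatio a w := by
  rw [norm_factorArg_eq ha]
  exact mul_le_mul_of_nonneg_right (by linarith) (boundaryRatio_pos ha hw).le

lemma norm_factorArg_le_two {a w : ℂ} (ha : ‖a‖ < 1) (hw : ‖w‖ < 1) : ‖factorArg a w‖ ≤ 2 :=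
  (norm_factorArg_le ha hw).trans (by linarith [boundaryRatio_le_one ha hw])

lemma one_sub_conj_mul_ne_zero {a w : ℂ} (ha : ‖a‖ < 1) (hw : ‖w‖ < 1) :
    1 - conj a * w ≠ 0 := norm_pos_iff.1 (norm_one_sub_pos ha hw)

lemma conj_mul_self_eq (a : ℂ) : conj a * a = (‖a‖ : ℂ) ^ 2 := Complex.conj_mul' a

lemma one_sub_factorArg {a w : ℂ} (ha : ‖a‖ < 1) (hw : ‖w‖ < 1) :
    1 - factorArg a w = conj a * (a - w) / (1 - conj a * w) := by
  rw [factorArg, eq_div_iff (one_sub_conj_mul_ne_zero ha hw), sub_mul,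
    div_mul_cancel₀ _ (one_sub_conj_mul_ne_zero ha hw), ← conj_mul_self_eq]
  ring

lemma factorArg_self {a : ℂ} (ha : ‖a‖ < 1) : factorArg a a = 1 := by
  have := one_sub_factorArg ha ha
  rw [sub_self, mul_zero, zero_div] at this
  exact (sub_eq_zero.1 this).symm

lemma primaryFactor_one (s : ℕ) : primaryFactor 1 s = 0 := by simp [primaryFactor]

lemma differentiableAt_factorArg {a w : ℂ} (ha : ‖a‖ < 1) (hw : ‖w‖ < 1) :
    DifferentiableAt ℂ (factorArg a) w := by
  unfold factorArg
  have := one_sub_conj_mul_ne_zero ha hw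
  fun_prop (disch := assumption)

lemma differentiableAt_factor {a w : ℂ} (s : ℕ) (ha : ‖a‖ < 1) (hw : ‖w‖ < 1) :
    DifferentiableAt ℂ (fun w => primaryFactor (factorArg a w) s) w :=
  (hasDerivAt_primaryFactor s (factorArg a w)).differentiableAt.comp w
    (differentiableAt_factorArg ha hw)

lemma norm_factor_sub_one_le {a w : ℂ} (s : ℕ) (ha : ‖a‖ < 1) (hw : ‖w‖ < 1) :
    ‖primaryFactor (factorArg a w) s - 1‖ ≤
      Real.exp (exponentBound s) * 2 ^ (s + 1) * boundaryRatio a w ^ (s + 1) := by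
  refine (norm_primaryFactor_sub_one_le (norm_factorArg_le_two ha hw) s).trans ?_
  rw [mul_assoc, ← mul_pow]
  gcongr
  exact norm_factorArg_le ha hw

lemma norm_factor_le {a w : ℂ} (s : ℕ) (ha : ‖a‖ < 1) (hw : ‖w‖ < 1) :
    ‖primaryFactor (factorArg a w) s‖ ≤ Real.exp
      (Real.exp (exponentBound s) * 2 ^ (s + 1) * boundaryRatio a w ^ (s + 1)) := by
  refine (norm_primaryFactor_le (norm_factorArg_le_two ha hw) s).trans ?_
  rw [mul_assoc, ← mul_pow]
  gcongr
  exact norm_factorArg_le ha hw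

/-- Up to a factor controlled by `boundaryRatio`, the modulus of the factor with zero `a` at a
point `w` is the distance of `a` and `w`, measured in units of `(1 - |w|) / 2` and cut off
at `1`. -/
lemma exists_factor_bounds (s : ℕ) {δ : ℝ} (hδ : 0 < δ) :
    ∃ C > (0 : ℝ), ∀ a w : ℂ, ‖a‖ < 1 → ‖w‖ < 1 → a ≠ w → δ ≤ ‖a‖ →
      Real.exp (-(C * boundaryRatio a w ^ (s + 1))) ≤
        ‖primaryFactor (factorArg a w) s‖ * max 1 ((1 - ‖w‖) / 2 / ‖a - w‖) ∧
      ‖primaryFactor (factorArg a w) s‖ * max 1 ((1 - ‖w‖) / 2 / ‖a - w‖) ≤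
        Real.exp (C * boundaryRatio a w ^ (s + 1)) := by
  obtain ⟨C₁, hC₁, hlow⟩ := exists_le_norm_primaryFactor s (d := δ / 5) (by positivity)
  set S := exponentBound s
  have hS : 0 ≤ S := exponentBound_nonneg s
  set C₂ := Real.exp S * 2 ^ (s + 1)
  have hC₂ : 0 < C₂ := by positivity
  set C₃ := 5 ^ (s + 1) * (S + |Real.log (δ / 5)|)
  have hC₃ : 0 ≤ C₃ := by positivity
  refine ⟨C₁ * 2 ^ (s + 1) + C₂ + C₃, by positivity, fun a w ha hw hne hδa => ?_⟩
  set u := boundaryRatio a w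
  have hu : 0 < u := boundaryRatio_pos ha hw
  set t := u ^ (s + 1)
  have ht : 0 < t := by positivity
  set d := ‖a - w‖
  have hd : 0 < d := norm_pos_iff.2 (sub_ne_zero.2 hne)
  set r := (1 - ‖w‖) / 2 with hr
  have hr0 : 0 < r := by simp only [r]; linarith
  set q := ‖1 - conj a * w‖
  have hq : 0 < q := norm_one_sub_pos ha hw
  have hq2 : 2 * r ≤ q := by
    have := one_sub_le_norm_right (w := w) ha.le
    rw [hr]; linarith
  have hq4 : q ≤ 4 * r + d := by
    have e : 1 - conj a * w = ((1 - ‖w‖ ^ 2 : ℝ) : ℂ) - conj (a - w) * w := by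
      push_cast
      rw [map_sub, sub_mul, conj_mul_self_eq]
      ring
    have h1 : q ≤ |1 - ‖w‖ ^ 2| + ‖conj (a - w) * w‖ := by
      simp only [q]
      rw [e]
      refine (norm_sub_le _ _).trans ?_
      rw [Complex.norm_real, Real.norm_eq_abs]
    rw [norm_mul, RCLike.norm_conj, abs_of_nonneg (by nlinarith [norm_nonneg w])] at h1
    have : d * ‖w‖ ≤ d := by nlinarith [norm_nonneg w]
    nlinarith [norm_nonneg w]
  have h1w : ‖1 - factorArg a w‖ = ‖a‖ * d / q := by
    rw [one_sub_factorArg ha hw, norm_div, norm_mul, RCLike.norm_conj]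
  rcases le_total r d with h | h
  · rw [max_eq_left ((div_le_one hd).2 h), mul_one]
    constructor
    · refine le_trans (Real.exp_le_exp.2 ?_) (hlow _ (norm_factorArg_le_two ha hw) ?_)
      · have h1 : ‖factorArg a w‖ ^ (s + 1) ≤ 2 ^ (s + 1) * t := by
          simp only [t]
          rw [← mul_pow]
          gcongr
          exact norm_factorArg_le ha hw
        have h2 : C₁ * ‖factorArg a w‖ ^ (s + 1) ≤ C₁ * (2 ^ (s + 1) * t) := by gcongr
        have h3 : 0 ≤ (C₂ + C₃) * t := by positivity
        nlinarith
      · rw [h1w, le_div_iff₀ hq]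
        nlinarith
    · refine (norm_factor_le s ha hw).trans (Real.exp_le_exp.2 ?_)
      change C₂ * t ≤ _
      have : 0 ≤ (C₁ * 2 ^ (s + 1) + C₃) * t := by positivity
      nlinarith
  · rw [max_eq_right ((one_le_div hd).2 h)]
    have hu5 : 1 / 5 ≤ u := by
      have h1 : ‖a‖ - ‖w‖ ≤ d := norm_sub_norm_le _ _
      have h2 : u = (1 - ‖a‖) / q := rfl
      rw [h2, le_div_iff₀ hq]
      rw [hr] at *
      linarith
    have ht5 : S + |Real.log (δ / 5)| ≤ C₃ * t := by
      have h1 : (1 / 5) ^ (s + 1) ≤ t := pow_le_pow_left₀ (by norm_num) hu5 _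
      have h2 : (1 : ℝ) ≤ 5 ^ (s + 1) * t := by
        rw [one_div, inv_pow, inv_le_iff_one_le_mul₀ (by positivity)] at h1
        linarith
      calc S + |Real.log (δ / 5)| ≤ (S + |Real.log (δ / 5)|) * (5 ^ (s + 1) * t) :=
            le_mul_of_one_le_right (by positivity) h2
        _ = C₃ * t := by simp only [C₃]; ring
    have hrest : 0 ≤ (C₁ * 2 ^ (s + 1) + C₂) * t := by positivity
    have hval : ‖primaryFactor (factorArg a w) s‖ * (r / d) = ‖a‖ * r / q *
        ‖Complex.exp (∑ j ∈ Finset.Icc 1 s, factorArg a w ^ j / (j : ℂ))‖ := by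
      rw [primaryFactor, norm_mul, h1w]
      field_simp
    rw [hval]
    have hw2 := norm_factorArg_le_two ha hw
    constructor
    · have h1 : -((C₁ * 2 ^ (s + 1) + C₂ + C₃) * t) ≤ Real.log (δ / 5) + -S := by
        have := neg_abs_le (Real.log (δ / 5))
        nlinarith
      refine (Real.exp_le_exp.2 h1).trans ?_
      rw [Real.exp_add, Real.exp_log (by positivity)]
      refine mul_le_mul ?_ (le_norm_exp_exponent hw2 s) (Real.exp_pos _).le (by positivity)
      rw [le_div_iff₀ hq]
      nlinarith
    · have h1 : ‖a‖ * r / q ≤ 1 := by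
        rw [div_le_one hq]
        nlinarith
      refine (mul_le_mul h1 (norm_exp_exponent_le hw2 s) (norm_nonneg _) zero_le_one).trans ?_
      rw [one_mul]
      refine Real.exp_le_exp.2 ?_
      have := abs_nonneg (Real.log (δ / 5))
      change S ≤ _
      nlinarith

/-! ### Products of primary factors -/

lemma exp_tsum_le_norm_tprod {ι : Type*} {f : ι → ℂ} (hf : Multipliable f) {α : ι → ℝ}
    (hα : Summable α) (h : ∀ i, Real.exp (α i) ≤ ‖f i‖) :
    Real.exp (∑' i, α i) ≤ ‖∏' i, f i‖ :=
  le_of_tendsto_of_tendsto' hα.hasSum.rexp hf.hasProd.norm fun _ =>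
    Finset.prod_le_prod (fun _ _ => (Real.exp_pos _).le) fun i _ => h i

lemma norm_tprod_le_exp_tsum {ι : Type*} {f : ι → ℂ} (hf : Multipliable f) {β : ι → ℝ}
    (hβ : Summable β) (h : ∀ i, ‖f i‖ ≤ Real.exp (β i)) :
    ‖∏' i, f i‖ ≤ Real.exp (∑' i, β i) :=
  le_of_tendsto_of_tendsto' hf.hasProd.norm hβ.hasSum.rexp fun _ =>
    Finset.prod_le_prod (fun _ _ => norm_nonneg _) fun i _ => h i

lemma summable_and_tsum_le_of_ennreal {ι : Type*} {f : ι → ℝ} (hf : ∀ i, 0 ≤ f i) {M : ℝ}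
    (hM : 0 ≤ M) (h : ∑' i, ENNReal.ofReal (f i) ≤ ENNReal.ofReal M) :
    Summable f ∧ ∑' i, f i ≤ M := by
  have hfin : ∀ F : Finset ι, ∑ i ∈ F, f i ≤ M := by
    intro F
    have := (ENNReal.sum_le_tsum F).trans h
    rwa [← ENNReal.ofReal_sum_of_nonneg fun i _ => hf i, ENNReal.ofReal_le_ofReal_iff hM] at this
  exact ⟨summable_of_sum_le hf hfin, Real.tsum_le_of_sum_le hf hfin⟩

section Product

variable {ι : Type*} {a : ι → ℂ} {s : ℕ}

lemma boundaryRatio_zero_right (a : ℂ) : boundaryRatio a 0 = 1 - ‖a‖ := by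
  simp [boundaryRatio]

lemma boundaryRatio_le_div {a w : ℂ} (ha : ‖a‖ < 1) {R : ℝ} (hR : R < 1) (hw : ‖w‖ ≤ R) :
    boundaryRatio a w ≤ (1 - ‖a‖) / (1 - R) := by
  have := one_sub_le_norm_right (w := w) ha.le
  exact div_le_div_of_nonneg_left (by linarith) (by linarith) (by linarith)

lemma multipliable_factor (ha : ∀ i, ‖a i‖ < 1) {w : ℂ} (hw : ‖w‖ < 1)
    (hsum : Summable fun i => boundaryRatio (a i) w ^ (s + 1)) :
    Multipliable fun i => primaryFactor (factorArg (a i) w) s := by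
  have h := multipliable_one_add_of_summable
    (f := fun i => primaryFactor (factorArg (a i) w) s - 1)
    ((hsum.mul_left _).of_nonneg_of_le (fun _ => norm_nonneg _)
      fun i => norm_factor_sub_one_le s (ha i) hw)
  simpa using h

lemma norm_tprod_factor_le (ha : ∀ i, ‖a i‖ < 1) {w : ℂ} (hw : ‖w‖ < 1)
    (hsum : Summable fun i => boundaryRatio (a i) w ^ (s + 1)) :
    ‖∏' i, primaryFactor (factorArg (a i) w) s‖ ≤ Real.exp
      (Real.exp (exponentBound s) * 2 ^ (s + 1) * ∑' i, boundaryRatio (a i) w ^ (s + 1)) := by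
  rw [← tsum_mul_left]
  exact norm_tprod_le_exp_tsum (multipliable_factor ha hw hsum) (hsum.mul_left _)
    fun i => norm_factor_le s (ha i) hw

lemma differentiableOn_tprod_factor (ha : ∀ i, ‖a i‖ < 1)
    (hsum : Summable fun i => (1 - ‖a i‖) ^ (s + 1)) :
    DifferentiableOn ℂ (fun w => ∏' i, primaryFactor (factorArg (a i) w) s)
      (Metric.ball 0 1) := by
  intro w₀ hw₀
  rw [mem_ball_zero_iff] at hw₀
  obtain ⟨R, hwR, hR⟩ := exists_between hw₀
  have hsub : ∀ w ∈ Metric.ball (0 : ℂ) R, ‖w‖ < 1 := fun w hw =>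
    (mem_ball_zero_iff.1 hw).trans hR
  have hd : ∀ i, DifferentiableOn ℂ (fun w => primaryFactor (factorArg (a i) w) s - 1)
      (Metric.ball 0 R) := fun i w hw =>
    ((differentiableAt_factor s (ha i) (hsub w hw)).sub_const 1).differentiableWithinAt
  have hu : Summable fun i => Real.exp (exponentBound s) * 2 ^ (s + 1) *
      ((1 - ‖a i‖) / (1 - R)) ^ (s + 1) := by
    simp_rw [div_pow]
    exact (hsum.div_const _).mul_left _
  have hP := hu.hasProdLocallyUniformlyOn_one_add
    (f := fun i w => primaryFactor (factorArg (a i) w) s - 1) Metric.isOpen_ball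
    (Eventually.of_forall fun i w hw => by
      refine (norm_factor_sub_one_le s (ha i) (hsub w hw)).trans ?_
      have h1 := boundaryRatio_le_div (ha i) hR (mem_ball_zero_iff.1 hw).le
      have h2 := (boundaryRatio_pos (ha i) (hsub w hw)).le
      gcongr) fun i => (hd i).continuousOn
  rw [hasProdLocallyUniformlyOn_iff_tendstoLocallyUniformlyOn] at hP
  have h := hP.differentiableOn (Eventually.of_forall fun F => ?_) Metric.isOpen_ball
  · simp only [add_sub_cancel] at h
    exact ((h w₀ (mem_ball_zero_iff.2 hwR)).differentiableAt
      (Metric.isOpen_ball.mem_nhds (mem_ball_zero_iff.2 hwR))).differentiableWithinAt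
  · refine DifferentiableOn.fun_finsetProd fun i _ => ?_
    exact (hd i).const_add 1

end Product

/-! ### The integrated counting function as a sum of logarithms -/

lemma lintegral_inv_indicator {d r : ℝ} (hd : 0 < d) :
    ∫⁻ t in Ioc (0 : ℝ) r, (Ici d).indicator (fun t => (ENNReal.ofReal t)⁻¹) t =
      ENNReal.ofReal (Real.log (max 1 (r / d))) := by
  rw [setLIntegral_indicator measurableSet_Ici]
  have hset : Ici d ∩ Ioc 0 r = Icc d r := by
    ext t
    exact ⟨fun h => ⟨h.1, h.2.2⟩, fun h => ⟨h.1, hd.trans_le h.1, h.2⟩⟩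
  rw [hset]
  rcases le_total d r with h | h
  · rw [max_eq_right ((one_le_div hd).2 h), ← integral_inv_of_pos hd (hd.trans_le h),
      intervalIntegral.integral_of_le h, ← integral_Icc_eq_integral_Ioc,
      ofReal_integral_eq_lintegral_ofReal]
    · refine setLIntegral_congr_fun measurableSet_Icc fun t ht => ?_
      exact (ENNReal.ofReal_inv_of_pos (hd.trans_le ht.1)).symm
    · exact (continuousOn_id.inv₀ fun t ht => (hd.trans_le ht.1).ne').integrableOn_Icc
    · refine (ae_restrict_iff' measurableSet_Icc).2 (Eventually.of_forall fun t ht => ?_)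
      exact inv_nonneg.2 (hd.le.trans ht.1)
  · rw [max_eq_left ((div_le_one hd).2 h), Real.log_one, ENNReal.ofReal_zero]
    refine setLIntegral_measure_zero _ _ ?_
    rw [Real.volume_Icc, ENNReal.ofReal_eq_zero]
    linarith

lemma integratedCounting_eq_tsum {z : ℕ → ℂ} (hinj : Function.Injective z) (n : ℕ) (r : ℝ) :
    integratedCounting z (z n) r =
      ∑' k : {k : ℕ // k ≠ n}, ENNReal.ofReal (Real.log (max 1 (r / ‖z k - z n‖))) := by
  have hd : ∀ k : {k : ℕ // k ≠ n}, 0 < ‖z k - z n‖ := fun k =>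
    norm_pos_iff.2 (sub_ne_zero.2 (hinj.ne k.2))
  have hpt : ∀ t ∈ Ioc (0 : ℝ) r, ((counting z (z n) t - 1 : ℕ∞) : ℝ≥0∞) / ENNReal.ofReal t =
      ∑' k : {k : ℕ // k ≠ n},
        (Ici ‖z k - z n‖).indicator (fun t => (ENNReal.ofReal t)⁻¹) t := by
    intro t ht
    have h1 : counting z (z n) t - 1 =
        {k : {k : ℕ // k ≠ n} | ‖z k - z n‖ ≤ t}.encard := by
      rw [counting, ← encard_sdiff_singleton_of_mem (a := n) (by simpa using ht.1.le),
        ← Subtype.val_injective.encard_image]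
      congr 1
      ext k
      simp [and_comm]
    rw [h1, ← ENNReal.tsum_set_one, div_eq_mul_inv, ← ENNReal.tsum_mul_right]
    simp only [one_mul]
    exact tsum_subtype {k : {k : ℕ // k ≠ n} | ‖z k - z n‖ ≤ t} fun _ => (ENNReal.ofReal t)⁻¹
  rw [integratedCounting, setLIntegral_congr_fun measurableSet_Ioc hpt, lintegral_tsum]
  · exact tsum_congr fun k => lintegral_inv_indicator (hd k)
  · intro k
    exact ((Measurable.inv (by fun_prop)).indicator measurableSet_Ici).aemeasurable

/-! ### The canonical product at the points of the sequence -/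

section Equivalence

variable {z : ℕ → ℂ} {ψ : ℝ → ℝ} {s : ℕ}

lemma one_le_one_div_one_sub {w : ℂ} (hw : ‖w‖ < 1) : 1 ≤ 1 / (1 - ‖w‖) :=
  (one_le_div (by linarith)).2 (by linarith [norm_nonneg w])

/-- The sum estimate in real form, with constant `C`: the series
`∑ₖ boundaryRatio (zₖ) w ^ (s + 1)` converges, with sum at most `C (ψ̃ + 1)`. -/
def BoundarySumBound (z : ℕ → ℂ) (ψ : ℝ → ℝ) (s : ℕ) (C : ℝ) : Prop :=
  ∀ w : ℂ, ‖w‖ < 1 → Summable (fun k => boundaryRatio (z k) w ^ (s + 1)) ∧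
    ∑' k, boundaryRatio (z k) w ^ (s + 1) ≤ C * (tilde ψ (1 / (1 - ‖w‖)) + 1)

lemma RegularGrowth.exists_boundarySumBound (h : RegularGrowth ψ s) (hs : 1 ≤ s)
    (hz : ∀ n, ‖z n‖ < 1)
    (hcount : ∃ C > (0 : ℝ), ∀ w : ℂ, ‖w‖ < 1 →
      ((counting z w ((1 - ‖w‖) / 2) : ℕ∞) : ENNReal) ≤
        ENNReal.ofReal (C * ψ (1 / (1 - ‖w‖)))) :
    ∃ C > (0 : ℝ), BoundarySumBound z ψ s C := by
  obtain ⟨C, hC, hle⟩ := h.tsum_boundaryRatio_le hz hs hcount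
  refine ⟨C, hC, fun w hw => summable_and_tsum_le_of_ennreal (fun k => ?_) ?_ (hle w hw)⟩
  · exact pow_nonneg (boundaryRatio_pos (hz k) hw).le _
  · have := h.tilde_nonneg (one_le_one_div_one_sub hw)
    positivity

lemma BoundarySumBound.subtype {C : ℝ} (hB : BoundarySumBound z ψ s C) (hz : ∀ n, ‖z n‖ < 1)
    (p : ℕ → Prop) {w : ℂ} (hw : ‖w‖ < 1) :
    Summable (fun k : {k // p k} => boundaryRatio (z k) w ^ (s + 1)) ∧
      ∑' k : {k // p k}, boundaryRatio (z k) w ^ (s + 1) ≤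
        C * (tilde ψ (1 / (1 - ‖w‖)) + 1) := by
  obtain ⟨h1, h2⟩ := hB w hw
  have h0 : ∀ k, 0 ≤ boundaryRatio (z k) w ^ (s + 1) := fun k =>
    pow_nonneg (boundaryRatio_pos (hz k) hw).le _
  exact ⟨h1.comp_injective Subtype.val_injective, (h1.tsum_subtype_le
    (fun k => boundaryRatio (z k) w ^ (s + 1)) {k | p k} h0).trans h2⟩

/-- The identity behind the equivalence of the three conditions: up to `O(ψ̃ + 1)`,
`-log |Bₙ(zₙ)|` is the integrated counting function at `zₙ`. -/
lemma exists_reducedProduct_bounds (hz : ∀ n, ‖z n‖ < 1) (hinj : Function.Injective z)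
    (hcount : ∃ C > (0 : ℝ), ∀ w : ℂ, ‖w‖ < 1 →
      ((counting z w ((1 - ‖w‖) / 2) : ℕ∞) : ENNReal) ≤
        ENNReal.ofReal (C * ψ (1 / (1 - ‖w‖))))
    {C : ℝ} (hB : BoundarySumBound z ψ s C) {δ : ℝ} (hδ : 0 < δ) (hzδ : ∀ n, δ ≤ ‖z n‖) :
    ∃ D > (0 : ℝ), ∀ n, ∃ L ≥ (0 : ℝ),
      integratedCounting z (z n) ((1 - ‖z n‖) / 2) = ENNReal.ofReal L ∧
      Real.exp (-(L + D * (C * (tilde ψ (1 / (1 - ‖z n‖)) + 1)))) ≤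
        ‖reducedProduct z s n (z n)‖ ∧
      ‖reducedProduct z s n (z n)‖ ≤
        Real.exp (D * (C * (tilde ψ (1 / (1 - ‖z n‖)) + 1)) - L) := by
  obtain ⟨D, hD, hfac⟩ := exists_factor_bounds s hδ
  obtain ⟨C₀, -, hcount⟩ := hcount
  refine ⟨D, hD, fun n => ?_⟩
  set T := C * (tilde ψ (1 / (1 - ‖z n‖)) + 1)
  set r := (1 - ‖z n‖) / 2
  set l : {k : ℕ // k ≠ n} → ℝ := fun k => Real.log (max 1 (r / ‖z k - z n‖)) with hl
  have hl0 : ∀ k, 0 ≤ l k := fun k => Real.log_nonneg (le_max_left _ _)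
  have hd : ∀ k : {k : ℕ // k ≠ n}, 0 < ‖z k - z n‖ := fun k =>
    norm_pos_iff.2 (sub_ne_zero.2 (hinj.ne k.2))
  have hls : Summable l := by
    have hfin : {k : ℕ | ‖z k - z n‖ ≤ r}.Finite := by
      rw [← encard_lt_top_iff, ← ENat.toENNReal_lt, ENat.toENNReal_top]
      exact (hcount (z n) (hz n)).trans_lt ENNReal.ofReal_lt_top
    refine summable_of_hasFiniteSupport ?_
    refine (hfin.preimage Subtype.val_injective.injOn).subset fun k hk => ?_
    by_contra hkr
    have hkr' : r < ‖z k - z n‖ := not_le.1 hkr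
    refine hk ?_
    simp only [hl]
    rw [max_eq_left ((div_le_one (hd k)).2 hkr'.le), Real.log_one]
  obtain ⟨hu, huT⟩ := hB.subtype hz (fun k => k ≠ n) (hz n)
  have hM := multipliable_factor (fun k : {k : ℕ // k ≠ n} => hz k) (hz n) hu
  have hexp : ∀ k, Real.exp (l k) = max 1 (r / ‖z k - z n‖) := fun k =>
    Real.exp_log (lt_max_of_lt_left one_pos)
  refine ⟨∑' k, l k, tsum_nonneg hl0, ?_, ?_, ?_⟩
  · rw [integratedCounting_eq_tsum hinj, ENNReal.ofReal_tsum_of_nonneg hl0 hls]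
  · refine le_trans ?_ (exp_tsum_le_norm_tprod hM
      (α := fun k => -(D * boundaryRatio (z k) (z n) ^ (s + 1)) - l k)
      ((hu.mul_left D).neg.sub hls) fun k => ?_)
    · rw [(hu.mul_left D).neg.tsum_sub hls, tsum_neg, tsum_mul_left]
      refine Real.exp_le_exp.2 ?_
      have := mul_le_mul_of_nonneg_left huT hD.le
      linarith
    · have h := (hfac (z k) (z n) (hz k) (hz n) (hinj.ne k.2) (hzδ k)).1
      rw [← hexp k] at h
      rw [Real.exp_sub, div_le_iff₀ (Real.exp_pos _)]
      exact h
  · refine (norm_tprod_le_exp_tsum hM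
      (β := fun k => D * boundaryRatio (z k) (z n) ^ (s + 1) - l k)
      ((hu.mul_left D).sub hls) fun k => ?_).trans ?_
    · have h := (hfac (z k) (z n) (hz k) (hz n) (hinj.ne k.2) (hzδ k)).2
      rw [← hexp k] at h
      rw [Real.exp_sub, le_div_iff₀ (Real.exp_pos _)]
      exact h
    · rw [(hu.mul_left D).tsum_sub hls, tsum_mul_left]
      refine Real.exp_le_exp.2 ?_
      have := mul_le_mul_of_nonneg_left huT hD.le
      linarith

lemma BoundarySumBound.differentiableOn_reducedProduct {C : ℝ} (hB : BoundarySumBound z ψ s C)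
    (hz : ∀ n, ‖z n‖ < 1) (n : ℕ) :
    DifferentiableOn ℂ (reducedProduct z s n) (Metric.ball 0 1) := by
  refine differentiableOn_tprod_factor (a := fun k : {k : ℕ // k ≠ n} => z k) (fun k => hz k) ?_
  simpa only [boundaryRatio_zero_right] using
    (hB.subtype hz (fun k => k ≠ n) (w := 0) (by simp)).1

lemma BoundarySumBound.canonicalProduct_eq_mul {C : ℝ} (hB : BoundarySumBound z ψ s C)
    (hz : ∀ n, ‖z n‖ < 1) (n : ℕ) {w : ℂ} (hw : ‖w‖ < 1) :
    canonicalProduct z s w = canonicalFactor z s n w * reducedProduct z s n w := by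
  have hu := (hB.subtype hz (fun k => k ≠ n) hw).1
  have hM := multipliable_factor (fun k : {k : ℕ // k ≠ n} => hz k) hw hu
  have h1 : HasProd ((fun k => canonicalFactor z s k w) ∘ ((↑) : ({n} : Set ℕ) → ℕ))
      (canonicalFactor z s n w) := hasProd_singleton n (fun k => canonicalFactor z s k w)
  exact (h1.mul_compl hM.hasProd).tprod_eq

lemma norm_deriv_factor_self {a : ℂ} (s : ℕ) (ha : ‖a‖ < 1) :
    ∃ E : ℝ, Real.exp (-exponentBound s) ≤ E ∧ E ≤ Real.exp (exponentBound s) ∧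
      ‖deriv (fun w => primaryFactor (factorArg a w) s) a‖ = E * (‖a‖ / (1 - ‖a‖ ^ 2)) := by
  refine ⟨‖Complex.exp (∑ j ∈ Finset.Icc 1 s, (1 : ℂ) ^ j / (j : ℂ))‖,
    le_norm_exp_exponent (by simp) s, norm_exp_exponent_le (by simp) s, ?_⟩
  have h0 : (1 : ℂ) - conj a * a ≠ 0 := one_sub_conj_mul_ne_zero ha ha
  have h1 : HasDerivAt (factorArg a)
      ((1 - (‖a‖ : ℂ) ^ 2) * conj a / (1 - conj a * a) ^ 2) a := by
    have h2 : HasDerivAt (fun w => 1 - conj a * w) (-(conj a * 1)) a :=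
      ((hasDerivAt_id a).const_mul (conj a)).const_sub 1
    have h3 := (hasDerivAt_const a (1 - (‖a‖ : ℂ) ^ 2)).div h2 h0
    refine h3.congr_deriv ?_
    ring
  have h2 := (hasDerivAt_primaryFactor s (factorArg a a)).comp a h1
  have h3 : deriv (fun w => primaryFactor (factorArg a w) s) a = _ := h2.deriv
  have hn : (1 - (‖a‖ : ℂ) ^ 2) = ((1 - ‖a‖ ^ 2 : ℝ) : ℂ) := by push_cast; ring
  have hpos : 0 < 1 - ‖a‖ ^ 2 := by nlinarith [norm_nonneg a]
  rw [h3, factorArg_self ha, one_pow, one_mul, conj_mul_self_eq, hn, norm_mul, norm_neg,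
    norm_div, norm_mul, norm_pow, Complex.norm_real, Real.norm_of_nonneg hpos.le,
    RCLike.norm_conj]
  field_simp

lemma BoundarySumBound.norm_deriv_canonicalProduct {C : ℝ} (hB : BoundarySumBound z ψ s C)
    (hz : ∀ n, ‖z n‖ < 1) (n : ℕ) :
    ∃ E : ℝ, Real.exp (-exponentBound s) ≤ E ∧ E ≤ Real.exp (exponentBound s) ∧
      (1 - ‖z n‖) * ‖deriv (canonicalProduct z s) (z n)‖ =
        E * (‖z n‖ / (1 + ‖z n‖)) * ‖reducedProduct z s n (z n)‖ := by
  obtain ⟨E, hE1, hE2, hE⟩ := norm_deriv_factor_self s (hz n)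
  refine ⟨E, hE1, hE2, ?_⟩
  have hmem : Metric.ball (0 : ℂ) 1 ∈ 𝓝 (z n) :=
    Metric.isOpen_ball.mem_nhds (mem_ball_zero_iff.2 (hz n))
  have heq : canonicalProduct z s =ᶠ[𝓝 (z n)]
      fun w => primaryFactor (factorArg (z n) w) s * reducedProduct z s n w := by
    filter_upwards [hmem] with w hw
    exact hB.canonicalProduct_eq_mul hz n (mem_ball_zero_iff.1 hw)
  have hd := ((differentiableAt_factor s (hz n) (hz n)).hasDerivAt.mul
    ((hB.differentiableOn_reducedProduct hz n).differentiableAt hmem).hasDerivAt)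
  have h0 : primaryFactor (factorArg (z n) (z n)) s = 0 := by
    rw [factorArg_self (hz n), primaryFactor_one]
  rw [h0, zero_mul, add_zero] at hd
  have hd' := hd.deriv
  rw [heq.deriv_eq]
  have h1 : 0 < 1 - ‖z n‖ := by linarith [hz n]
  have h2 : 0 < 1 + ‖z n‖ := by linarith [norm_nonneg (z n)]
  have h3 : 1 - ‖z n‖ ^ 2 = (1 - ‖z n‖) * (1 + ‖z n‖) := by ring
  refine Eq.trans (congrArg _ (congrArg norm hd')) ?_
  rw [norm_mul, hE, h3]
  field_simp

end Equivalence

section Conditions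

variable {z : ℕ → ℂ} {ψ : ℝ → ℝ} {s : ℕ}

/-! ### The points stay away from the region where `ψ̃` vanishes -/

lemma pos_of_mem_counting {C : ℝ} (hC : 0 < C)
    (hcount : ∀ w : ℂ, ‖w‖ < 1 → ((counting z w ((1 - ‖w‖) / 2) : ℕ∞) : ENNReal) ≤
      ENNReal.ofReal (C * ψ (1 / (1 - ‖w‖))))
    {w : ℂ} (hw : ‖w‖ < 1) {k : ℕ} (hk : ‖z k - w‖ ≤ (1 - ‖w‖) / 2) :
    0 < ψ (1 / (1 - ‖w‖)) := by
  by_contra! hψ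
  have h := hcount w hw
  rw [ENNReal.ofReal_eq_zero.2 (mul_nonpos_of_nonneg_of_nonpos hC.le hψ), nonpos_iff_eq_zero,
    ENat.toENNReal_eq_zero, counting, encard_eq_zero] at h
  exact (h ▸ (show k ∈ {k : ℕ | ‖z k - w‖ ≤ (1 - ‖w‖) / 2} from hk) : k ∈ (∅ : Set ℕ))

/-- If `0` is not a point of the sequence, then the sequence avoids a disc on whose boundary
`ψ̃` is already positive. If `ψ 1 > 0` then every small disc does. If `ψ` vanishes up to `x₀`,
then the counting assumption keeps the points out of the disc of radius `1 - 1 / (2 x₀)`. -/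
lemma RegularGrowth.exists_inner_radius (h : RegularGrowth ψ s) (hz : ∀ n, ‖z n‖ < 1)
    (hu : ¬ BddAbove (ψ '' Ici 1))
    (hcount : ∃ C > (0 : ℝ), ∀ w : ℂ, ‖w‖ < 1 →
      ((counting z w ((1 - ‖w‖) / 2) : ℕ∞) : ENNReal) ≤
        ENNReal.ofReal (C * ψ (1 / (1 - ‖w‖))))
    (hnz : ∀ n, z n ≠ 0) :
    ∃ δ r : ℝ, 0 < r ∧ r < δ ∧ δ ≤ 1 ∧ (∀ n, δ ≤ ‖z n‖) ∧ 0 < tilde ψ (1 / (1 - r)) := by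
  obtain ⟨C, hC, hcount⟩ := hcount
  rcases (h.nonneg 1 (mem_Ici.2 le_rfl)).lt_or_eq with h1 | h1
  · have hfin : {k : ℕ | ‖z k‖ ≤ 1 / 2}.Finite := by
      rw [← encard_lt_top_iff, ← ENat.toENNReal_lt, ENat.toENNReal_top]
      have := (hcount 0 (by simp)).trans_lt ENNReal.ofReal_lt_top
      simpa [counting] using this
    have hopen : (z '' {k : ℕ | ‖z k‖ ≤ 1 / 2})ᶜ ∈ 𝓝 (0 : ℂ) := by
      refine (hfin.image z).isClosed.isOpen_compl.mem_nhds ?_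
      rintro ⟨k, -, hk⟩
      exact hnz k hk
    obtain ⟨ε, hε, hball⟩ := Metric.mem_nhds_iff.1 hopen
    have hδ : 0 < min ε (1 / 2) := lt_min hε (by norm_num)
    have hδ2 : min ε (1 / 2) ≤ 1 / 2 := min_le_right _ _
    refine ⟨min ε (1 / 2), min ε (1 / 2) / 2, by linarith, by linarith, by linarith,
      fun n => ?_, ?_⟩
    · by_contra! hn
      exact hball (mem_ball_zero_iff.2 (hn.trans_le (min_le_left _ _)))
        ⟨n, (hn.trans_le (min_le_right _ _)).le, rfl⟩
    · have hx : 1 < 1 / (1 - min ε (1 / 2) / 2) := by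
        rw [lt_div_iff₀ (by linarith)]
        linarith
      have h2 := h.integral_ge le_rfl hx.le
      rw [div_one] at h2
      exact (mul_pos h1 (Real.log_pos hx)).trans_le h2
  · set Z := {x : ℝ | 1 ≤ x ∧ ψ x = 0}
    obtain ⟨X, hX, hpos⟩ := exists_ge_of_not_bddAbove h.mono hu 0
    have hZb : BddAbove Z := ⟨X, fun x hx => by
      by_contra! hlt
      exact (hpos x hlt.le).ne' hx.2⟩
    have hZ1 : (1 : ℝ) ∈ Z := ⟨le_rfl, h1.symm⟩
    set x₀ := sSup Z
    have hx₀ : 1 ≤ x₀ := le_csSup hZb hZ1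
    obtain ⟨x, ⟨hx1, hx⟩, hxx₀⟩ := exists_lt_of_lt_csSup ⟨1, hZ1⟩
      (show 2 / 3 * x₀ < x₀ by linarith)
    have e1 : 1 / (1 - (1 - 1 / (4 / 3 * x₀))) = 4 / 3 * x₀ := by simp
    refine ⟨1 - 1 / (2 * x), 1 - 1 / (4 / 3 * x₀), ?_, ?_, ?_, fun n => ?_, ?_⟩
    · have : 1 / (4 / 3 * x₀) < 1 := by
        rw [div_lt_one (by linarith)]
        linarith
      linarith
    · have : 1 / (2 * x) < 1 / (4 / 3 * x₀) :=
        one_div_lt_one_div_of_lt (by linarith) (by linarith)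
      linarith
    · have : 0 < 1 / (2 * x) := by positivity
      linarith
    · by_contra! hn
      have hn1 : 0 < 1 - ‖z n‖ := by linarith [hz n]
      rcases le_total (1 / (1 - ‖z n‖)) x with hle | hle
      · have h2 := pos_of_mem_counting hC hcount (hz n) (k := n) (by simp; linarith)
        have h3 := h.mono (mem_Ici.2 (one_le_one_div_one_sub (hz n))) (mem_Ici.2 hx1) hle
        linarith
      · -- the point at distance `1 - 1 / x` from the origin in the direction of `z n`
        set ρ := 1 - 1 / x with hρ
        have hρ0 : 0 ≤ ρ := by
          have : 1 / x ≤ 1 := (div_le_one (by linarith)).2 hx1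
          linarith
        have hzn : 0 < ‖z n‖ := norm_pos_iff.2 (hnz n)
        set w : ℂ := ((ρ / ‖z n‖ : ℝ) : ℂ) * z n
        have hw : ‖w‖ = ρ := by
          simp only [w]
          rw [norm_mul, Complex.norm_real, Real.norm_of_nonneg (by positivity),
            div_mul_cancel₀ _ hzn.ne']
        have hρz : ρ ≤ ‖z n‖ := by
          have : 1 - ‖z n‖ ≤ 1 / x := (le_one_div hn1 (by linarith)).2 hle
          linarith
        have hwz : ‖z n - w‖ = ‖z n‖ - ρ := by
          have e : z n - w = ((1 - ρ / ‖z n‖ : ℝ) : ℂ) * z n := by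
            simp only [w]; push_cast; ring
          rw [e, norm_mul, Complex.norm_real, Real.norm_of_nonneg, sub_mul, one_mul,
            div_mul_cancel₀ _ hzn.ne']
          linarith [(div_le_one hzn).2 hρz]
        have hx0 : 0 < 1 / x := by positivity
        have h2 := pos_of_mem_counting hC hcount (w := w) (by rw [hw]; linarith) (k := n) (by
          rw [hwz, hw]
          have : 1 / (2 * x) = 1 / x / 2 := by ring
          linarith)
        rw [hw, hρ, sub_sub_cancel, one_div_one_div, hx] at h2
        exact lt_irrefl _ h2
    · rw [e1, h.tilde_add (a := 7 / 6 * x₀) (by linarith) (by linarith)]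
      have h2 := h.integral_ge (a := 7 / 6 * x₀) (b := 4 / 3 * x₀) (by linarith) (by linarith)
      have h3 := h.tilde_nonneg (x := 7 / 6 * x₀) (by linarith)
      have h4 : 0 < ψ (7 / 6 * x₀) := by
        refine (h.nonneg _ (mem_Ici.2 (by linarith))).lt_of_ne fun h0 => ?_
        have := le_csSup hZb (show 7 / 6 * x₀ ∈ Z from ⟨by linarith, h0.symm⟩)
        have : 7 / 6 * x₀ ≤ x₀ := this
        linarith
      have h5 : 0 < Real.log (4 / 3 * x₀ / (7 / 6 * x₀)) := by
        refine Real.log_pos ?_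
        rw [lt_div_iff₀ (by linarith)]
        linarith
      have := mul_pos h4 h5
      linarith

/-! ### The equivalence of the three conditions -/

/-- The constants for the equivalence: `-log |Bₙ(zₙ)|` and the integrated counting function
differ by at most a multiple of `ψ̃`, and so do `-log |Bₙ(zₙ)|` and
`-log ((1 - |zₙ|) |P'(zₙ)|)`. -/
lemma RegularGrowth.exists_comparison (h : RegularGrowth ψ s) (hs : 1 ≤ s)
    (hz : ∀ n, ‖z n‖ < 1) (hinj : Function.Injective z) (hu : ¬ BddAbove (ψ '' Ici 1))
    (hcount : ∃ C > (0 : ℝ), ∀ w : ℂ, ‖w‖ < 1 →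
      ((counting z w ((1 - ‖w‖) / 2) : ℕ∞) : ENNReal) ≤
        ENNReal.ofReal (C * ψ (1 / (1 - ‖w‖))))
    (hnz : ∀ n, z n ≠ 0) :
    ∃ M > (0 : ℝ), ∀ n, 0 ≤ tilde ψ (1 / (1 - ‖z n‖)) ∧ reducedProduct z s n (z n) ≠ 0 ∧
      deriv (canonicalProduct z s) (z n) ≠ 0 ∧
      (∃ L ≥ (0 : ℝ), integratedCounting z (z n) ((1 - ‖z n‖) / 2) = ENNReal.ofReal L ∧
        |L + Real.log ‖reducedProduct z s n (z n)‖| ≤ M * tilde ψ (1 / (1 - ‖z n‖))) ∧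
      |Real.log ((1 - ‖z n‖) * ‖deriv (canonicalProduct z s) (z n)‖) -
        Real.log ‖reducedProduct z s n (z n)‖| ≤ M * tilde ψ (1 / (1 - ‖z n‖)) := by
  obtain ⟨δ, r, hr, hrδ, hδ1, hzδ, hc⟩ := h.exists_inner_radius hz hu hcount hnz
  have hδ : 0 < δ := hr.trans hrδ
  set c := tilde ψ (1 / (1 - r))
  obtain ⟨C, hC, hB⟩ := h.exists_boundarySumBound hs hz hcount
  obtain ⟨D, hD, hbd⟩ := exists_reducedProduct_bounds hz hinj hcount hB hδ hzδ
  have hS := exponentBound_nonneg s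
  set S := exponentBound s
  set M₁ := S + |Real.log (δ / 2)|
  have hM₁ : 0 ≤ M₁ := by positivity
  refine ⟨D * C * (1 + 1 / c) + M₁ / c, by positivity, fun n => ?_⟩
  obtain ⟨L, hL, hLN, hlow, hup⟩ := hbd n
  set τ := tilde ψ (1 / (1 - ‖z n‖))
  have hcτ : c ≤ τ := by
    have h1 := hz n
    have h2 := hzδ n
    refine h.tilde_mono ((one_le_div (by linarith)).2 (by linarith)) ?_
    exact one_div_le_one_div_of_le (by linarith) (by linarith)
  have hτ : 0 ≤ τ := hc.le.trans hcτ
  have hτc : 1 ≤ 1 / c * τ := by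
    rw [one_div_mul_eq_div, one_le_div hc]
    exact hcτ
  have hB0 : 0 < ‖reducedProduct z s n (z n)‖ := (Real.exp_pos _).trans_le hlow
  obtain ⟨E, hE1, hE2, hE⟩ := hB.norm_deriv_canonicalProduct hz n
  have hE0 : 0 < E := (Real.exp_pos _).trans_le hE1
  set q := E * (‖z n‖ / (1 + ‖z n‖))
  have hzn : 0 < ‖z n‖ := hδ.trans_le (hzδ n)
  have hq0 : 0 < q := by positivity
  have hqlow : Real.exp (-S) * (δ / 2) ≤ q := by
    have hfrac : δ / 2 ≤ ‖z n‖ / (1 + ‖z n‖) := by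
      rw [div_le_div_iff₀ (by norm_num) (by linarith)]
      nlinarith [hz n, hzδ n]
    exact mul_le_mul hE1 hfrac (by positivity) hE0.le
  have hqup : q ≤ Real.exp S := by
    have hfrac : ‖z n‖ / (1 + ‖z n‖) ≤ 1 := (div_le_one (by linarith)).2 (by linarith)
    exact (mul_le_of_le_one_right hE0.le hfrac).trans hE2
  have hlogq : |Real.log q| ≤ M₁ := by
    have h1 := Real.log_le_log (by positivity) hqlow
    have h2 := Real.log_le_log hq0 hqup
    rw [Real.log_mul (Real.exp_pos _).ne' (by positivity), Real.log_exp] at h1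
    rw [Real.log_exp] at h2
    have h3 := neg_abs_le (Real.log (δ / 2))
    have h4 := abs_nonneg (Real.log (δ / 2))
    rw [abs_le]
    constructor <;> simp only [M₁] <;> linarith
  refine ⟨hτ, norm_pos_iff.1 hB0, fun h0 => ?_, ⟨L, hL, hLN, ?_⟩, ?_⟩
  · rw [h0, norm_zero, mul_zero] at hE
    exact (mul_pos hq0 hB0).ne hE
  · have h1 := Real.log_le_log (Real.exp_pos _) hlow
    have h2 := Real.log_le_log hB0 hup
    rw [Real.log_exp] at h1 h2
    have h3 : D * (C * (τ + 1)) ≤ D * C * (1 + 1 / c) * τ := by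
      have := mul_le_mul_of_nonneg_left hτc (by positivity : 0 ≤ D * C)
      nlinarith
    have h4 : 0 ≤ M₁ / c * τ := by positivity
    rw [abs_le]
    constructor <;> nlinarith
  · rw [hE, Real.log_mul hq0.ne' hB0.ne', add_sub_cancel_right]
    refine hlogq.trans ?_
    have h3 : M₁ ≤ M₁ / c * τ := by
      have := mul_le_mul_of_nonneg_left hτc hM₁
      calc M₁ = M₁ * 1 := (mul_one _).symm
        _ ≤ _ := this
        _ = _ := by ring
    have h4 : 0 ≤ D * C * (1 + 1 / c) * τ := by positivity
    nlinarith

lemma RegularGrowth.conditions_equivalent (h : RegularGrowth ψ s) (hs : 1 ≤ s)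
    (hz : ∀ n, ‖z n‖ < 1) (hinj : Function.Injective z) (hu : ¬ BddAbove (ψ '' Ici 1))
    (hcount : ∃ C > (0 : ℝ), ∀ w : ℂ, ‖w‖ < 1 →
      ((counting z w ((1 - ‖w‖) / 2) : ℕ∞) : ENNReal) ≤
        ENNReal.ofReal (C * ψ (1 / (1 - ‖w‖))))
    (hnz : ∀ n, z n ≠ 0) :
    (IntegratedCountingBound z (tilde ψ) ↔ DerivLowerBound z s (tilde ψ)) ∧
      (IntegratedCountingBound z (tilde ψ) ↔ ReducedProductLowerBound z s (tilde ψ)) := by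
  obtain ⟨M, hM, hcomp⟩ := h.exists_comparison hs hz hinj hu hcount hnz
  have hac : IntegratedCountingBound z (tilde ψ) ↔ ReducedProductLowerBound z s (tilde ψ) := by
    constructor
    · rintro ⟨C, hC, hle⟩
      refine ⟨C + M, by positivity, fun n => ?_⟩
      obtain ⟨hτ, hB, -, ⟨L, hL, hLN, hLB⟩, -⟩ := hcomp n
      refine ⟨hB, ?_⟩
      have h1 := hle n
      rw [hLN, ENNReal.ofReal_le_ofReal_iff (by positivity)] at h1
      have h2 := (abs_le.1 hLB).1
      linarith
    · rintro ⟨C, hC, hle⟩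
      refine ⟨C + M, by positivity, fun n => ?_⟩
      obtain ⟨hτ, -, -, ⟨L, hL, hLN, hLB⟩, -⟩ := hcomp n
      rw [hLN]
      refine ENNReal.ofReal_le_ofReal ?_
      have h1 := (hle n).2
      have h2 := (abs_le.1 hLB).2
      linarith
  refine ⟨hac.trans ?_, hac⟩
  constructor
  · rintro ⟨C, hC, hle⟩
    refine ⟨C + M, by positivity, fun n => ?_⟩
    obtain ⟨-, -, hP, -, hPB⟩ := hcomp n
    refine ⟨hP, ?_⟩
    have h1 := (hle n).2
    have h2 := (abs_le.1 hPB).1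
    linarith
  · rintro ⟨C, hC, hle⟩
    refine ⟨C + M, by positivity, fun n => ?_⟩
    obtain ⟨-, hB, -, -, hPB⟩ := hcomp n
    refine ⟨hB, ?_⟩
    have h1 := (hle n).2
    have h2 := (abs_le.1 hPB).2
    linarith

end Conditions

/-! ### The interpolation series -/

section Interpolation

variable {z : ℕ → ℂ} {ψ : ℝ → ℝ} {s : ℕ}

lemma reducedProduct_eq_zero (hz : ∀ n, ‖z n‖ < 1) {n k : ℕ} (hkn : k ≠ n) :
    reducedProduct z s n (z k) = 0 := by
  refine tprod_of_exists_eq_zero ⟨⟨k, hkn⟩, ?_⟩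
  rw [canonicalFactor_eq, factorArg_self (hz k), primaryFactor_one]

/-- The choice of the exponents in the interpolation series: with `N ≥ 2 K T(zₙ)`, the factor
`v ^ N`, `v = factorArg (zₙ) w`, compensates `exp (K T(zₙ))` where `|v| ≤ 1 / 2`. Elsewhere
`1 - |w| ≤ 4 (1 - |zₙ|)`, so that `T(zₙ)` is dominated by `T(w)`. -/
lemma RegularGrowth.exists_exp_mul_pow_le (h : RegularGrowth ψ s) {K : ℝ} (hK : 0 ≤ K) :
    ∃ D > (0 : ℝ), ∀ a w : ℂ, ‖a‖ < 1 → ‖w‖ < 1 →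
      Real.exp (K * (tilde ψ (1 / (1 - ‖a‖)) + 1)) *
        ‖factorArg a w‖ ^ ⌈2 * (K * (tilde ψ (1 / (1 - ‖a‖)) + 1))⌉₊ ≤
      Real.exp (D * (tilde ψ (1 / (1 - ‖w‖)) + 1)) := by
  obtain ⟨C, hC, h4⟩ := h.tilde_four_mul_le
  refine ⟨3 * (K * C) + 1, by positivity, fun a w ha hw => ?_⟩
  have hta := h.tilde_nonneg (one_le_one_div_one_sub ha)
  have htw := h.tilde_nonneg (one_le_one_div_one_sub hw)
  set ta := tilde ψ (1 / (1 - ‖a‖)) + 1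
  set tw := tilde ψ (1 / (1 - ‖w‖)) + 1
  have hta1 : 1 ≤ ta := by simp only [ta]; linarith
  have htw1 : 1 ≤ tw := by simp only [tw]; linarith
  set N := ⌈2 * (K * ta)⌉₊
  have hN1 : 2 * (K * ta) ≤ N := Nat.le_ceil _
  have hN2 : (N : ℝ) < 2 * (K * ta) + 1 := Nat.ceil_lt_add_one (by positivity)
  have hlog1 := Real.log_two_gt_d9
  have hlog2 := Real.log_two_lt_d9
  have h2N : (2 : ℝ) ^ N = Real.exp (N * Real.log 2) := by
    rw [← Real.log_pow, Real.exp_log (by positivity)]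
  have hKa : 0 ≤ K * ta := by positivity
  rcases le_total ‖factorArg a w‖ (1 / 2) with hv | hv
  · calc Real.exp (K * ta) * ‖factorArg a w‖ ^ N ≤ Real.exp (K * ta) * (1 / 2) ^ N := by gcongr
      _ = Real.exp (K * ta - N * Real.log 2) := by
          rw [Real.exp_sub, ← h2N, one_div, inv_pow, div_eq_mul_inv]
      _ ≤ _ := by
          refine Real.exp_le_exp.2 ?_
          have : 0 ≤ (3 * (K * C) + 1) * tw := by positivity
          nlinarith
  · have hcmp : ta ≤ C * tw := by
      have h1 := norm_factorArg_le ha hw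
      have h2 : 1 / 4 ≤ boundaryRatio a w := by linarith
      rw [boundaryRatio, le_div_iff₀ (norm_one_sub_pos ha hw)] at h2
      have h3 := one_sub_le_norm_right (w := w) ha.le
      refine le_trans ?_ (h4 _ (one_le_one_div_one_sub hw))
      have h5 : 1 / (1 - ‖a‖) ≤ 4 * (1 / (1 - ‖w‖)) := by
        rw [mul_one_div, div_le_div_iff₀ (by linarith) (by linarith)]
        linarith
      have := h.tilde_mono (one_le_one_div_one_sub ha) h5
      simp only [ta]
      linarith
    calc Real.exp (K * ta) * ‖factorArg a w‖ ^ N ≤ Real.exp (K * ta) * 2 ^ N := by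
          gcongr
          exact norm_factorArg_le_two ha hw
      _ = Real.exp (K * ta + N * Real.log 2) := by rw [Real.exp_add, ← h2N]
      _ ≤ _ := by
          refine Real.exp_le_exp.2 ?_
          have h6 : K * ta ≤ K * (C * tw) := by gcongr
          have h7 : (N : ℝ) * Real.log 2 ≤ N := by
            have : (0 : ℝ) ≤ N := Nat.cast_nonneg _
            nlinarith
          nlinarith

/-- Interpolation with bounds that are uniform in the data, under a lower bound for `|Bₙ(zₙ)|`.
The solution is `∑ₙ bₙ Bₙ(w) / Bₙ(zₙ) vₙ(w) ^ (Nₙ + s + 1)` with `vₙ = factorArg (zₙ)`: the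
power `Nₙ` compensates the size of `bₙ / Bₙ(zₙ)`, and the power `s + 1` makes the series
converge. -/
lemma RegularGrowth.exists_interpolation (h : RegularGrowth ψ s) (hz : ∀ n, ‖z n‖ < 1)
    {C : ℝ} (hC : 0 < C) (hB : BoundarySumBound z ψ s C)
    {K : ℝ} (hK : 0 ≤ K) (hlow : ∀ n, Real.exp (-(K * (tilde ψ (1 / (1 - ‖z n‖)) + 1))) ≤
      ‖reducedProduct z s n (z n)‖) {C₀ : ℝ} (hC₀ : 0 ≤ C₀) :
    ∃ C₁ > (0 : ℝ), ∀ b : ℕ → ℂ,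
      (∀ n, ‖b n‖ ≤ Real.exp (C₀ * (tilde ψ (1 / (1 - ‖z n‖)) + 1))) →
      ∃ f : ℂ → ℂ, DifferentiableOn ℂ f (Metric.ball 0 1) ∧ (∀ n, f (z n) = b n) ∧
        ∀ w : ℂ, ‖w‖ < 1 → ‖f w‖ ≤ Real.exp (C₁ * (tilde ψ (1 / (1 - ‖w‖)) + 1)) := by
  obtain ⟨D, hD, hpow⟩ := h.exists_exp_mul_pow_le (K := C₀ + K) (by positivity)
  set K₂ := Real.exp (exponentBound s) * 2 ^ (s + 1)
  have hK₂ : 0 < K₂ := by positivity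
  refine ⟨K₂ * C + D + 2 ^ (s + 1) * C, by positivity, fun b hb => ?_⟩
  set T : ℂ → ℝ := fun w => tilde ψ (1 / (1 - ‖w‖)) + 1
  have hT1 : ∀ w : ℂ, ‖w‖ < 1 → 1 ≤ T w := fun w hw => by
    have := h.tilde_nonneg (one_le_one_div_one_sub hw)
    simp only [T]
    linarith
  set N : ℕ → ℕ := fun n => ⌈2 * ((C₀ + K) * T (z n))⌉₊
  set g : ℕ → ℂ → ℂ := fun n w =>
    b n / reducedProduct z s n (z n) * reducedProduct z s n w *
      factorArg (z n) w ^ (N n + (s + 1))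
  have hg : ∀ n w, ‖w‖ < 1 → ‖g n w‖ ≤
      Real.exp ((K₂ * C + D) * T w) * 2 ^ (s + 1) * boundaryRatio (z n) w ^ (s + 1) := by
    intro n w hw
    have h1 : ‖b n / reducedProduct z s n (z n)‖ ≤ Real.exp ((C₀ + K) * T (z n)) := by
      rw [norm_div, div_le_iff₀ ((Real.exp_pos _).trans_le (hlow n))]
      refine (hb n).trans ?_
      calc Real.exp (C₀ * T (z n))
          = Real.exp ((C₀ + K) * T (z n)) * Real.exp (-(K * T (z n))) := by
            rw [← Real.exp_add]; ring_nf
        _ ≤ _ := by gcongr; exact hlow n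
    have h2 : ‖reducedProduct z s n w‖ ≤ Real.exp (K₂ * (C * T w)) := by
      obtain ⟨hu, huT⟩ := hB.subtype hz (fun k => k ≠ n) hw
      refine (norm_tprod_factor_le (fun k : {k : ℕ // k ≠ n} => hz k) hw hu).trans ?_
      gcongr
    have h3 := hpow (z n) w (hz n) hw
    have h4 : ‖factorArg (z n) w‖ ^ (s + 1) ≤ 2 ^ (s + 1) * boundaryRatio (z n) w ^ (s + 1) := by
      rw [← mul_pow]
      gcongr
      exact norm_factorArg_le (hz n) hw
    calc ‖g n w‖ = ‖b n / reducedProduct z s n (z n)‖ * ‖reducedProduct z s n w‖ *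
          (‖factorArg (z n) w‖ ^ N n * ‖factorArg (z n) w‖ ^ (s + 1)) := by
          simp only [g]
          rw [norm_mul, norm_mul, norm_pow, pow_add]
      _ ≤ Real.exp ((C₀ + K) * T (z n)) * Real.exp (K₂ * (C * T w)) *
          (‖factorArg (z n) w‖ ^ N n *
            (2 ^ (s + 1) * boundaryRatio (z n) w ^ (s + 1))) := by gcongr
      _ = (Real.exp ((C₀ + K) * T (z n)) * ‖factorArg (z n) w‖ ^ N n) *
          Real.exp (K₂ * (C * T w)) *
            (2 ^ (s + 1) * boundaryRatio (z n) w ^ (s + 1)) := by ring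
      _ ≤ Real.exp (D * T w) * Real.exp (K₂ * (C * T w)) *
            (2 ^ (s + 1) * boundaryRatio (z n) w ^ (s + 1)) := by
          have := (boundaryRatio_pos (hz n) hw).le
          gcongr
      _ = _ := by
          rw [← Real.exp_add, ← mul_assoc]
          ring_nf
  refine ⟨fun w => ∑' n, g n w, ?_, fun k => ?_, fun w hw => ?_⟩
  · intro w₀ hw₀
    rw [mem_ball_zero_iff] at hw₀
    obtain ⟨R, hwR, hR⟩ := exists_between hw₀
    have hR0 : 0 ≤ R := (norm_nonneg _).trans hwR.le
    have hRn : ‖(R : ℂ)‖ = R := by rw [Complex.norm_real, Real.norm_of_nonneg hR0]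
    have hsum : Summable fun n => Real.exp ((K₂ * C + D) * T R) * 2 ^ (s + 1) *
        ((1 - ‖z n‖) / (1 - R)) ^ (s + 1) := by
      have h0 := (hB 0 (by simp)).1
      simp_rw [boundaryRatio_zero_right] at h0
      simp_rw [div_pow]
      exact (h0.div_const _).mul_left _
    have hd := Complex.differentiableOn_tsum_of_summable_norm hsum (F := g) (U := Metric.ball 0 R)
      (fun n w hw => ?_) Metric.isOpen_ball fun n w hw => ?_
    · have hnhds : Metric.ball (0 : ℂ) R ∈ 𝓝 w₀ :=
        Metric.isOpen_ball.mem_nhds (mem_ball_zero_iff.2 hwR)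
      exact (hd.differentiableAt hnhds).differentiableWithinAt
    · have hw1 : ‖w‖ < 1 := (mem_ball_zero_iff.1 hw).trans hR
      have h1 := (hB.differentiableOn_reducedProduct hz n).differentiableAt
        (Metric.isOpen_ball.mem_nhds (mem_ball_zero_iff.2 hw1))
      exact ((h1.const_mul _).mul
        ((differentiableAt_factorArg (hz n) hw1).pow _)).differentiableWithinAt
    · have hwR' : ‖w‖ < R := mem_ball_zero_iff.1 hw
      have hw1 : ‖w‖ < 1 := hwR'.trans hR
      refine (hg n w hw1).trans ?_
      have hTR : T w ≤ T R := by
        simp only [T]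
        rw [hRn]
        have := h.tilde_mono (one_le_one_div_one_sub hw1)
          (one_div_le_one_div_of_le (by linarith) (by linarith : 1 - R ≤ 1 - ‖w‖))
        linarith
      have h1 := boundaryRatio_le_div (hz n) hR hwR'.le
      have h2 := (boundaryRatio_pos (hz n) hw1).le
      gcongr
  · have h0 : reducedProduct z s k (z k) ≠ 0 :=
      norm_pos_iff.1 ((Real.exp_pos _).trans_le (hlow k))
    change ∑' n, g n (z k) = b k
    rw [tsum_eq_single k]
    · simp only [g]
      rw [factorArg_self (hz k), one_pow, mul_one, div_mul_cancel₀ _ h0]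
    · intro n hn
      simp only [g]
      rw [reducedProduct_eq_zero hz hn.symm, mul_zero, zero_mul]
  · obtain ⟨hu, huT⟩ := hB w hw
    have hT := hT1 w hw
    have h1 : ‖∑' n, g n w‖ ≤ ∑' n, Real.exp ((K₂ * C + D) * T w) * 2 ^ (s + 1) *
        boundaryRatio (z n) w ^ (s + 1) :=
      tsum_of_norm_bounded (hu.mul_left _).hasSum fun n => hg n w hw
    rw [tsum_mul_left] at h1
    refine h1.trans ?_
    calc Real.exp ((K₂ * C + D) * T w) * 2 ^ (s + 1) * ∑' n, boundaryRatio (z n) w ^ (s + 1)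
        ≤ Real.exp ((K₂ * C + D) * T w) * 2 ^ (s + 1) * (C * T w) := by gcongr
      _ = Real.exp ((K₂ * C + D) * T w) * (2 ^ (s + 1) * C * T w) := by ring
      _ ≤ Real.exp ((K₂ * C + D) * T w) * Real.exp (2 ^ (s + 1) * C * T w) := by
          gcongr
          linarith [Real.add_one_le_exp (2 ^ (s + 1) * C * T w)]
      _ = _ := by
          rw [← Real.exp_add]
          congr 1
          simp only [T]
          ring

/-- Interpolation with bounds that are uniform in the data, for sequences that avoid `0`. -/
lemma RegularGrowth.exists_interpolation_of_ne_zero (h : RegularGrowth ψ s) (hs : 1 ≤ s)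
    (hz : ∀ n, ‖z n‖ < 1) (hinj : Function.Injective z) (hu : ¬ BddAbove (ψ '' Ici 1))
    (hcount : ∃ C > (0 : ℝ), ∀ w : ℂ, ‖w‖ < 1 →
      ((counting z w ((1 - ‖w‖) / 2) : ℕ∞) : ENNReal) ≤
        ENNReal.ofReal (C * ψ (1 / (1 - ‖w‖))))
    (hnz : ∀ n, z n ≠ 0) (ha : IntegratedCountingBound z (tilde ψ)) {C₀ : ℝ} (hC₀ : 0 ≤ C₀) :
    ∃ C₁ > (0 : ℝ), ∀ b : ℕ → ℂ,
      (∀ n, ‖b n‖ ≤ Real.exp (C₀ * (tilde ψ (1 / (1 - ‖z n‖)) + 1))) →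
      ∃ f : ℂ → ℂ, DifferentiableOn ℂ f (Metric.ball 0 1) ∧ (∀ n, f (z n) = b n) ∧
        ∀ w : ℂ, ‖w‖ < 1 → ‖f w‖ ≤ Real.exp (C₁ * (tilde ψ (1 / (1 - ‖w‖)) + 1)) := by
  obtain ⟨C, hC, hB⟩ := h.exists_boundarySumBound hs hz hcount
  obtain ⟨K, hK, hlow⟩ := (h.conditions_equivalent hs hz hinj hu hcount hnz).2.1 ha
  refine h.exists_interpolation hz hC hB hK.le (fun n => ?_) hC₀
  obtain ⟨h0, h1⟩ := hlow n
  rw [← Real.le_log_iff_exp_le (norm_pos_iff.2 h0)]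
  linarith

lemma log_maxModulus_le {f : ℂ → ℂ} {M : ℝ} (hM : 0 ≤ M) {r : ℝ} (hr : 0 ≤ r)
    (hf : ∀ w : ℂ, ‖w‖ = r → ‖f w‖ ≤ Real.exp M) : Real.log (maxModulus r f) ≤ M := by
  have hne : ((fun w => ‖f w‖) '' Metric.sphere (0 : ℂ) r).Nonempty :=
    (NormedSpace.sphere_nonempty.2 hr).image _
  have hle : maxModulus r f ≤ Real.exp M := by
    refine csSup_le hne ?_
    rintro _ ⟨w, hw, rfl⟩
    exact hf w (mem_sphere_zero_iff_norm.1 hw)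
  have h0 : 0 ≤ maxModulus r f := by
    refine Real.sSup_nonneg ?_
    rintro _ ⟨w, -, rfl⟩
    exact norm_nonneg _
  rcases h0.lt_or_eq with h1 | h1
  · exact (Real.log_le_iff_le_exp h1).2 hle
  · rw [← h1, Real.log_zero]
    exact hM

lemma norm_le_exp_of_log_le {b : ℂ} {M : ℝ} (h : Real.log ‖b‖ ≤ M) : ‖b‖ ≤ Real.exp M := by
  rcases (norm_nonneg b).lt_or_eq with h1 | h1
  · exact (Real.log_le_iff_le_exp h1).1 h
  · rw [← h1]
    exact (Real.exp_pos _).le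

/-- Interpolation with the sharp bound `exp (C ψ̃)`, for sequences that avoid `0`. The factor
`(w / δ) ^ m`, where no point of the sequence has modulus less than `δ`, makes the interpolating
function at most `1` in modulus in a disc outside which `ψ̃` is bounded below. -/
lemma RegularGrowth.exists_interpolation_sharp (h : RegularGrowth ψ s) (hs : 1 ≤ s)
    (hz : ∀ n, ‖z n‖ < 1) (hinj : Function.Injective z) (hu : ¬ BddAbove (ψ '' Ici 1))
    (hcount : ∃ C > (0 : ℝ), ∀ w : ℂ, ‖w‖ < 1 →
      ((counting z w ((1 - ‖w‖) / 2) : ℕ∞) : ENNReal) ≤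
        ENNReal.ofReal (C * ψ (1 / (1 - ‖w‖))))
    (hnz : ∀ n, z n ≠ 0) (ha : IntegratedCountingBound z (tilde ψ)) {b : ℕ → ℂ} {C₀ : ℝ}
    (hC₀ : 0 ≤ C₀) (hb : ∀ n, ‖b n‖ ≤ Real.exp (C₀ * tilde ψ (1 / (1 - ‖z n‖)))) :
    ∃ f : ℂ → ℂ, DifferentiableOn ℂ f (Metric.ball 0 1) ∧ (∀ n, f (z n) = b n) ∧
      ∃ C > (0 : ℝ), ∀ w : ℂ, ‖w‖ < 1 →
        ‖f w‖ ≤ Real.exp (C * tilde ψ (1 / (1 - ‖w‖))) := by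
  obtain ⟨δ, r, hr, hrδ, hδ1, hzδ, hc⟩ := h.exists_inner_radius hz hu hcount hnz
  have hδ : 0 < δ := hr.trans hrδ
  set c := tilde ψ (1 / (1 - r))
  obtain ⟨C₁, hC₁, hint⟩ :=
    h.exists_interpolation_of_ne_zero hs hz hinj hu hcount hnz ha hC₀
  obtain ⟨m, hm⟩ := exists_pow_lt_of_lt_one (Real.exp_pos (-(C₁ * (c + 1))))
    ((div_lt_one hδ).2 hrδ)
  have hnorm : ∀ v : ℂ, ‖v / (δ : ℂ)‖ = ‖v‖ / δ := fun v => by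
    rw [norm_div, Complex.norm_real, Real.norm_of_nonneg hδ.le]
  obtain ⟨g, hg, hgz, hgb⟩ := hint (fun n => b n / (z n / (δ : ℂ)) ^ m) fun n => by
    have h1 : 1 ≤ ‖z n / (δ : ℂ)‖ ^ m := by
      rw [hnorm]
      exact one_le_pow₀ ((one_le_div hδ).2 (hzδ n))
    rw [norm_div, norm_pow]
    refine (div_le_self (norm_nonneg _) h1).trans ((hb n).trans (Real.exp_le_exp.2 ?_))
    gcongr
    linarith
  have hlog : 0 ≤ Real.log (1 / δ) := Real.log_nonneg ((one_le_div hδ).2 hδ1)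
  refine ⟨fun w => (w / (δ : ℂ)) ^ m * g w, ?_, fun n => ?_,
    m * Real.log (1 / δ) / c + C₁ * (1 + 1 / c), by positivity, fun w hw => ?_⟩
  · exact DifferentiableOn.mul (by fun_prop) hg
  · have : (z n / (δ : ℂ)) ^ m ≠ 0 :=
      pow_ne_zero _ (div_ne_zero (hnz n) (by exact_mod_cast hδ.ne'))
    change (z n / (δ : ℂ)) ^ m * g (z n) = b n
    rw [hgz, mul_div_cancel₀ _ this]
  · have ht := h.tilde_nonneg (one_le_one_div_one_sub hw)
    set τ := tilde ψ (1 / (1 - ‖w‖))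
    change ‖(w / (δ : ℂ)) ^ m * g w‖ ≤ _
    rw [norm_mul, norm_pow, hnorm]
    rcases le_total ‖w‖ r with hwr | hwr
    · have hτc : τ ≤ c := h.tilde_mono (one_le_one_div_one_sub hw)
        (one_div_le_one_div_of_le (by linarith) (by linarith))
      calc (‖w‖ / δ) ^ m * ‖g w‖ ≤ (r / δ) ^ m * Real.exp (C₁ * (τ + 1)) := by
            gcongr
            exact hgb w hw
        _ ≤ Real.exp (-(C₁ * (c + 1))) * Real.exp (C₁ * (c + 1)) := by gcongr
        _ = 1 := by rw [← Real.exp_add]; simp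
        _ ≤ _ := Real.one_le_exp (by positivity)
    · have hcτ : c ≤ τ := h.tilde_mono ((one_le_div (by linarith)).2 (by linarith))
        (one_div_le_one_div_of_le (by linarith) (by linarith))
      have hτc : 1 ≤ 1 / c * τ := by
        rw [one_div_mul_eq_div, one_le_div hc]
        exact hcτ
      calc (‖w‖ / δ) ^ m * ‖g w‖ ≤ (1 / δ) ^ m * Real.exp (C₁ * (τ + 1)) := by
            gcongr
            exact hgb w hw
        _ = Real.exp (m * Real.log (1 / δ) + C₁ * (τ + 1)) := by
            rw [Real.exp_add, ← Real.log_pow, Real.exp_log (by positivity)]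
        _ ≤ _ := by
            refine Real.exp_le_exp.2 ?_
            have h1 := mul_le_mul_of_nonneg_left hτc
              (by positivity : 0 ≤ m * Real.log (1 / δ))
            have h2 := mul_le_mul_of_nonneg_left hτc hC₁.le
            have e : m * Real.log (1 / δ) / c = m * Real.log (1 / δ) * (1 / c) := by ring
            rw [e]
            nlinarith

end Interpolation

/-! ### Sequences through the origin -/

section Origin

variable {z : ℕ → ℂ} {ψ : ℝ → ℝ} {s : ℕ}

/-- The increasing enumeration of the indices different from `n₀`. -/
def skipIndex (n₀ k : ℕ) : ℕ := if k < n₀ then k else k + 1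

lemma skipIndex_injective (n₀ : ℕ) : Function.Injective (skipIndex n₀) := by
  intro j k hjk
  unfold skipIndex at hjk
  split_ifs at hjk <;> omega

lemma skipIndex_ne (n₀ k : ℕ) : skipIndex n₀ k ≠ n₀ := by
  unfold skipIndex
  split_ifs <;> omega

lemma exists_skipIndex_eq {n₀ n : ℕ} (hn : n ≠ n₀) : ∃ k, skipIndex n₀ k = n := by
  rcases lt_or_gt_of_ne hn with h | h
  · exact ⟨n, by unfold skipIndex; rw [if_pos h]⟩
  · exact ⟨n - 1, by unfold skipIndex; rw [if_neg (by omega)]; omega⟩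

lemma counting_comp_le {e : ℕ → ℕ} (he : Function.Injective e) (ζ : ℂ) (t : ℝ) :
    counting (z ∘ e) ζ t ≤ counting z ζ t := by
  rw [counting, ← he.encard_image]
  refine encard_le_encard ?_
  rintro _ ⟨k, hk, rfl⟩
  exact hk

lemma integratedCounting_comp_le {e : ℕ → ℕ} (he : Function.Injective e) (ζ : ℂ) (r : ℝ) :
    integratedCounting (z ∘ e) ζ r ≤ integratedCounting z ζ r := by
  refine lintegral_mono fun t => ENNReal.div_le_div_right ?_ _
  exact ENat.toENNReal_le.2 (tsub_le_tsub_right (counting_comp_le he ζ t) 1)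

/-- If the sequence passes through `0`, the factor with zero `0` is identically zero, as is the
canonical product, so that its derivative vanishes. -/
lemma not_derivLowerBound {n₀ : ℕ} (h0 : z n₀ = 0) (Ψ : ℝ → ℝ) :
    ¬ DerivLowerBound z s Ψ := by
  rintro ⟨C, -, hC⟩
  refine (hC 0).1 ?_
  have : canonicalProduct z s = fun _ => 0 := by
    funext w
    refine tprod_of_exists_eq_zero ⟨n₀, ?_⟩
    simp [canonicalFactor, h0, primaryFactor]
  rw [this, deriv_const]

lemma not_reducedProductLowerBound {n₀ : ℕ} (h0 : z n₀ = 0) (Ψ : ℝ → ℝ) :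
    ¬ ReducedProductLowerBound z s Ψ := by
  rintro ⟨C, -, hC⟩
  refine (hC (n₀ + 1)).1 ?_
  refine tprod_of_exists_eq_zero ⟨⟨n₀, by omega⟩, ?_⟩
  simp [canonicalFactor, h0, primaryFactor]

/-- Interpolation with the sharp bound for sequences through `0`: interpolate
`(bₙ - b_{n₀}) / zₙ` at the other points by `g`, and take `b_{n₀} + w g(w)`. Near `0` the bound
holds because `ψ̃ (1 / (1 - |w|)) ≥ ψ 1 |w|`, where `ψ 1 > 0` by the counting assumption. -/
lemma RegularGrowth.exists_interpolation_sharp_origin (h : RegularGrowth ψ s) (hs : 1 ≤ s)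
    (hz : ∀ n, ‖z n‖ < 1) (hinj : Function.Injective z) (hu : ¬ BddAbove (ψ '' Ici 1))
    (hcount : ∃ C > (0 : ℝ), ∀ w : ℂ, ‖w‖ < 1 →
      ((counting z w ((1 - ‖w‖) / 2) : ℕ∞) : ENNReal) ≤
        ENNReal.ofReal (C * ψ (1 / (1 - ‖w‖))))
    {n₀ : ℕ} (h0 : z n₀ = 0) (ha : IntegratedCountingBound z (tilde ψ)) {b : ℕ → ℂ} {C₀ : ℝ}
    (hC₀ : 0 ≤ C₀) (hb : ∀ n, ‖b n‖ ≤ Real.exp (C₀ * tilde ψ (1 / (1 - ‖z n‖)))) :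
    ∃ f : ℂ → ℂ, DifferentiableOn ℂ f (Metric.ball 0 1) ∧ (∀ n, f (z n) = b n) ∧
      ∃ C > (0 : ℝ), ∀ w : ℂ, ‖w‖ < 1 →
        ‖f w‖ ≤ Real.exp (C * tilde ψ (1 / (1 - ‖w‖))) := by
  have hψ1 : 0 < ψ 1 := by
    obtain ⟨C, hC, hc⟩ := hcount
    simpa using pos_of_mem_counting hC hc (w := 0) (k := n₀) (by simp) (by simp [h0])
  have hb0 : ‖b n₀‖ ≤ 1 := by
    have := hb n₀
    simpa [h0, tilde] using this
  set e := skipIndex n₀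
  have he := skipIndex_injective n₀
  set y : ℕ → ℂ := z ∘ e
  have hy : ∀ k, ‖y k‖ < 1 := fun k => hz _
  have hyinj : Function.Injective y := hinj.comp he
  have hyn : ∀ k, y k ≠ 0 := fun k hk => skipIndex_ne n₀ k (hinj (hk.trans h0.symm))
  have hycount : ∃ C > (0 : ℝ), ∀ w : ℂ, ‖w‖ < 1 →
      ((counting y w ((1 - ‖w‖) / 2) : ℕ∞) : ENNReal) ≤
        ENNReal.ofReal (C * ψ (1 / (1 - ‖w‖))) := by
    obtain ⟨C, hC, hc⟩ := hcount
    exact ⟨C, hC, fun w hw =>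
      (ENat.toENNReal_le.2 (counting_comp_le he w _)).trans (hc w hw)⟩
  have hya : IntegratedCountingBound y (tilde ψ) := by
    obtain ⟨C, hC, hc⟩ := ha
    exact ⟨C, hC, fun k => (integratedCounting_comp_le he _ _).trans (hc (e k))⟩
  obtain ⟨δ, r, hr, hrδ, hδ1, hyδ, -⟩ := h.exists_inner_radius hy hu hycount hyn
  have hδ : 0 < δ := hr.trans hrδ
  have hlog2 : 0 ≤ Real.log (2 / δ) :=
    Real.log_nonneg ((one_le_div hδ).2 (by linarith))
  obtain ⟨C₁, hC₁, hint⟩ := h.exists_interpolation_of_ne_zero hs hy hyinj hu hycount hyn hya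
    (C₀ := C₀ + Real.log (2 / δ)) (by positivity)
  obtain ⟨g, hg, hgy, hgb⟩ := hint (fun k => (b (e k) - b n₀) / y k) fun k => by
    have ht := h.tilde_nonneg (one_le_one_div_one_sub (hy k))
    have h1 := hb (e k)
    change ‖b (e k)‖ ≤ Real.exp (C₀ * tilde ψ (1 / (1 - ‖y k‖))) at h1
    set τ := tilde ψ (1 / (1 - ‖y k‖))
    have h2 : 1 ≤ Real.exp (C₀ * τ) := Real.one_le_exp (by positivity)
    have h3 : ‖b (e k) - b n₀‖ ≤ 2 * Real.exp (C₀ * τ) := (norm_sub_le _ _).trans (by linarith)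
    rw [norm_div, div_le_iff₀ (hδ.trans_le (hyδ k))]
    calc ‖b (e k) - b n₀‖ ≤ 2 * Real.exp (C₀ * τ) := h3
      _ = Real.exp (C₀ * τ + Real.log (2 / δ)) * δ := by
          rw [Real.exp_add, Real.exp_log (by positivity)]
          field_simp
      _ ≤ Real.exp ((C₀ + Real.log (2 / δ)) * (τ + 1)) * ‖y k‖ := by
          gcongr
          · nlinarith
          · exact hyδ k
  refine ⟨fun w => b n₀ + w * g w, ?_, fun n => ?_,
    Real.exp (C₁ * 2) / ψ 1 + (C₁ * 2 + 1), by positivity, fun w hw => ?_⟩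
  · exact (differentiableOn_id.mul hg).const_add _
  · change b n₀ + z n * g (z n) = b n
    rcases eq_or_ne n n₀ with rfl | hn
    · rw [h0, zero_mul, add_zero]
    · obtain ⟨k, rfl⟩ := exists_skipIndex_eq hn
      have := hgy k
      change g (z (skipIndex n₀ k)) = (b (skipIndex n₀ k) - b n₀) / z (skipIndex n₀ k) at this
      rw [this, mul_div_cancel₀ _ (show z (skipIndex n₀ k) ≠ 0 from hyn k)]
      ring
  · have ht := h.tilde_nonneg (one_le_one_div_one_sub hw)
    have hgw := hgb w hw
    have hw1 : 0 < 1 - ‖w‖ := by linarith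
    have hlin : ψ 1 * ‖w‖ ≤ tilde ψ (1 / (1 - ‖w‖)) := by
      have h1 := h.integral_ge le_rfl (one_le_one_div_one_sub hw)
      rw [div_one] at h1
      have h2 : ‖w‖ ≤ Real.log (1 / (1 - ‖w‖)) := by
        rw [one_div, Real.log_inv]
        linarith [Real.log_le_sub_one_of_pos hw1]
      exact (mul_le_mul_of_nonneg_left h2 hψ1.le).trans h1
    set τ := tilde ψ (1 / (1 - ‖w‖))
    have h1 : ‖b n₀ + w * g w‖ ≤ 1 + ‖w‖ * Real.exp (C₁ * (τ + 1)) := by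
      refine (norm_add_le _ _).trans ?_
      rw [norm_mul]
      gcongr
    refine h1.trans ?_
    rcases le_total τ 1 with hτ | hτ
    · calc 1 + ‖w‖ * Real.exp (C₁ * (τ + 1)) ≤ 1 + τ / ψ 1 * Real.exp (C₁ * 2) := by
            gcongr
            · rw [le_div_iff₀ hψ1]
              linarith
            · linarith
        _ = Real.exp (C₁ * 2) / ψ 1 * τ + 1 := by ring
        _ ≤ Real.exp (Real.exp (C₁ * 2) / ψ 1 * τ) := Real.add_one_le_exp _
        _ ≤ _ := by
            refine Real.exp_le_exp.2 ?_
            gcongr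
            have : 0 < C₁ * 2 + 1 := by positivity
            linarith
    · calc 1 + ‖w‖ * Real.exp (C₁ * (τ + 1))
          ≤ 1 * Real.exp (C₁ * (τ + 1)) + 1 * Real.exp (C₁ * (τ + 1)) := by
            gcongr
            rw [one_mul]
            exact Real.one_le_exp (by positivity)
        _ = 2 * Real.exp (C₁ * (τ + 1)) := by ring
        _ ≤ Real.exp 1 * Real.exp (C₁ * (τ + 1)) := by
            gcongr
            linarith [Real.add_one_le_exp (1 : ℝ)]
        _ = Real.exp (1 + C₁ * (τ + 1)) := by rw [Real.exp_add]
        _ ≤ _ := by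
            refine Real.exp_le_exp.2 ?_
            have h2 : 0 ≤ Real.exp (C₁ * 2) / ψ 1 * τ := by positivity
            nlinarith

end Origin

end DiscInterpolation

open DiscInterpolation
theorem mainTheorem1 (z : ℕ → ℂ) (hz : ∀ n, ‖z n‖ < 1) (hinj : Function.Injective z)
    (ψ : ℝ → ℝ) (hψ_nonneg : ∀ x ∈ Set.Ici (1 : ℝ), 0 ≤ ψ x)
    (hψ_mono : MonotoneOn ψ (Set.Ici 1))
    (hψ_unbdd : ¬ BddAbove (ψ '' Set.Ici 1))
    (hψ_doubling : (fun x => ψ (2 * x)) =O[Filter.atTop] ψ)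
    (hcount : ∃ C > (0 : ℝ), ∀ w : ℂ, ‖w‖ < 1 →
      ((counting z w ((1 - ‖w‖) / 2) : ℕ∞) : ENNReal) ≤ ENNReal.ofReal (C * ψ (1 / (1 - ‖w‖))))
    (s : ℕ) (hs : ⌊polyaOrder ψ⌋ + 1 ≤ (s : ℤ)) :
    ((∀ n, z n ≠ 0) →
      (IntegratedCountingBound z (tilde ψ) ↔ DerivLowerBound z s (tilde ψ)) ∧
      (IntegratedCountingBound z (tilde ψ) ↔ ReducedProductLowerBound z s (tilde ψ))) ∧
    (IntegratedCountingBound z (tilde ψ) ∨ DerivLowerBound z s (tilde ψ) ∨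
        ReducedProductLowerBound z s (tilde ψ) →
      ∀ b : ℕ → ℂ,
        (∃ C > (0 : ℝ), ∀ n, Real.log ‖b n‖ ≤ C * tilde ψ (1 / (1 - ‖z n‖))) →
        ∃ f : ℂ → ℂ, AnalyticOnNhd ℂ f (Metric.ball 0 1) ∧ (∀ n, f (z n) = b n) ∧
          ∃ C > (0 : ℝ), ∀ r ∈ Set.Ioo (0 : ℝ) 1,
            Real.log (maxModulus r f) ≤ C * tilde ψ (1 / (1 - r))) := by
  obtain ⟨hs1, h⟩ := regularGrowth_of_polyaOrder hψ_nonneg hψ_mono hψ_unbdd hψ_doubling hs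
  refine ⟨fun hnz => h.conditions_equivalent hs1 hz hinj hψ_unbdd hcount hnz,
    fun hcond b hb => ?_⟩
  obtain ⟨C₀, hC₀, hb⟩ := hb
  have hb' : ∀ n, ‖b n‖ ≤ Real.exp (C₀ * tilde ψ (1 / (1 - ‖z n‖))) := fun n =>
    norm_le_exp_of_log_le (hb n)
  have hf : ∃ f : ℂ → ℂ, DifferentiableOn ℂ f (Metric.ball 0 1) ∧ (∀ n, f (z n) = b n) ∧
      ∃ C > (0 : ℝ), ∀ w : ℂ, ‖w‖ < 1 →
        ‖f w‖ ≤ Real.exp (C * tilde ψ (1 / (1 - ‖w‖))) := by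
    by_cases hnz : ∀ n, z n ≠ 0
    · have hequiv := h.conditions_equivalent hs1 hz hinj hψ_unbdd hcount hnz
      have ha : IntegratedCountingBound z (tilde ψ) := by
        rcases hcond with ha | hd | hc
        exacts [ha, hequiv.1.2 hd, hequiv.2.2 hc]
      exact h.exists_interpolation_sharp hs1 hz hinj hψ_unbdd hcount hnz ha hC₀.le hb'
    · push Not at hnz
      obtain ⟨n₀, h0⟩ := hnz
      have ha : IntegratedCountingBound z (tilde ψ) := by
        rcases hcond with ha | hd | hc
        exacts [ha, (not_derivLowerBound h0 _ hd).elim,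
          (not_reducedProductLowerBound h0 _ hc).elim]
      exact h.exists_interpolation_sharp_origin hs1 hz hinj hψ_unbdd hcount h0 ha hC₀.le hb'
  obtain ⟨f, hfd, hfz, C, hC, hfb⟩ := hf
  refine ⟨f, hfd.analyticOnNhd Metric.isOpen_ball, hfz, C, hC, fun r hr => ?_⟩
  have hx : 1 ≤ 1 / (1 - r) := (one_le_div (by linarith [hr.2])).2 (by linarith [hr.1])
  refine log_maxModulus_le (mul_nonneg hC.le (h.tilde_nonneg hx)) hr.1.le fun w hw => ?_
  rw [← hw]
  exact hfb w (hw.trans_lt hr.2)
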